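/- Let $\ell\ge 3$ be an integer, $\ell'=\ell/\gcd(\ell,2)$, $\xi^x=\exp(2\pi i x/\ell)$ for $x\in\mathbb C$, $\{x\}=\xi^x-\xi^{-x}$ and $\{n\}!=\{n\}\{n-1\}\cdots\{1\}$. Let $\mathcal U^K$ be the $\mathbb C$-algebra with generators $E$, $F$, $K^\alpha$ $(\alpha\in\mathbb C)$, where $K=K^1$, and relations $$K^\alpha K^\beta=K^{\alpha+\beta},\quad K^0=1,\quad K^\alpha EK^{-\alpha}=\xi^{2\alpha}E,\quad K^\alpha FK^{-\alpha}=\xi^{-2\alpha}F,\quad EF-FE=\frac{K-K^{-1}}{\xi-\xi^{-1}},\quad E^{\ell'}=F^{\ell'}=0 .$$ It is a Hopf algebra with $\Delta(E)=1\otimes E+E\otimes K$, $\Delta(F)=K^{-1}\otimes F+F\otimes 1$, $\Delta(K^\alpha)=K^\alpha\otimes K^\alpha$, $\varepsilon(E)=\varepsilon(F)=0$, $\varepsilon(K^\alpha)=1$, $S(E)=-EK^{-1}$, $S(F)=-KF$, $S(K^\alpha)=K^{-\alpha}$. For $a\in G=\mathbb C/2\mathbb Z$ put $\mathbf U_a=\mathcal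 U^K/(K^{\ell/2}-\xi^{\ell a/2})$. The Hopf algebra structure of $\mathcal U^K$ induces on $\mathbf U=\{\mathbf U_a\}_{a\in G}$ the structure of a Hopf $G$-coalgebra, with algebra maps $\Delta_{a,b}:\mathbf U_{a+b}\to\mathbf U_a\otimes\mathbf U_b$ and $\varepsilon:\mathbf U_0\to\mathbb C$, and bijective antipodes $S_a:\mathbf U_a\to\mathbf U_{-a}$. For $a,b\in G$ and $\alpha,\beta\in\mathbb C$ congruent modulo $\mathbb Z$ to $\frac a2$, $\frac b2$ respectively, let $$\mathcal H_{a,b}=\frac1{\ell'}\sum_{m_1,m_2=0}^{\ell'-1}\xi^{-2(m_1+\beta)(m_2+\alpha)}K^{\beta+m_1}\otimes K^{\alpha+m_2},\qquad \check{\mathcal R}_{a,b}=\sum_{n=0}^{\ell'-1}\frac{\{1\}^{2n}}{\{n\}!}\,\xi^{n(n-1)/2}E^n\otimes F^n$$ in $\mathbf U_a\otimes\mathbf U_b$. **Theorem.** The element $\mathcal H_{a,b}$ does not depend on the choice of $\alpha$ and $\beta$, and $\mathbf U$ is a ribbon Hopf $G$-coalgebra with pivot $g_a=K^{1-\ell'}\in\mathbf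 U_a$ and R-matrix $\mathcal R_{a,b}=\mathcal H_{a,b}\check{\mathcal R}_{a,b}$. That is, with $\tau(x\otimes y)=y\otimes x$ and $m_a$ the product of $\mathbf U_a$, for all $a,b,c\in G$: 1. $\Delta_{a,b}(g_{a+b})=g_a\otimes g_b$, $\varepsilon(g_0)=1$, and $S_{-a}S_a(x)=g_axg_a^{-1}$ for $x\in\mathbf U_a$; 2. $\mathcal R_{a,b}$ is invertible, and $\mathcal R_{a,b}\,\Delta_{a,b}(x)=\tau(\Delta_{b,a}(x))\,\mathcal R_{a,b}$ for $x\in\mathbf U_{a+b}$; 3. $(\mathrm{Id}\otimes\Delta_{b,c})\mathcal R_{a,b+c}=(\mathcal R_{a,c})_{1b3}(\mathcal R_{a,b})_{12c}$ and $(\Delta_{a,b}\otimes\mathrm{Id})\mathcal R_{a+b,c}=(\mathcal R_{a,c})_{1b3}(\mathcal R_{b,c})_{a23}$, where, writing $\mathcal R_{a,b}=r_a\otimes s_b$ (summation understood), $(\mathcal R_{a,c})_{1b3}=r_a\otimes1_b\otimes s_c$, $(\mathcal R_{a,b})_{12c}=r_a\otimes s_b\otimes1_c$ and $(\mathcal R_{b,c})_{a23}=1_a\otimes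 r_b\otimes s_c$; 4. $m_a\bigl(\tau((g_a\otimes1_a)\mathcal R_{a,a})\bigr)=m_a\bigl((1_a\otimes g_a^{-1})\mathcal R_{a,a}\bigr)$. -/

import Mathlib

open scoped TensorProduct

/-! ## Hopf `G`-coalgebras over an abelian group `G` -/

section HopfGCoalgebras

universe u v w

variable {𝕜 : Type u} [CommRing 𝕜] {G : Type v} [AddCommGroup G]
variable {H : G → Type w} [∀ a, Ring (H a)] [∀ a, Algebra 𝕜 (H a)]

/-- The identification `H a = H b` for equal indices `a = b`. -/
def gcast (𝕜 : Type u) [CommRing 𝕜] {G : Type v} (H : G → Type w) [∀ a, Ring (H a)]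
    [∀ a, Algebra 𝕜 (H a)] {a b : G} (h : a = b) : H a ≃ₐ[𝕜] H b :=
  h ▸ AlgEquiv.refl

/-- A Hopf `G`-coalgebra structure on a family `H` of `𝕜`-algebras, `G` an additive abelian group:
coproducts `Δ_{a,b} : H_{a+b} → H_a ⊗ H_b` and a counit `ε : H_0 → 𝕜`, which are algebra maps,
and bijective antipodes `S_a : H_a → H_{-a}`. -/
structure HopfGCoalgebra (𝕜 : Type u) [CommRing 𝕜] {G : Type v} [AddCommGroup G]
    (H : G → Type w) [∀ a, Ring (H a)] [∀ a, Algebra 𝕜 (H a)] where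
  comul (a b : G) : H (a + b) →ₐ[𝕜] H a ⊗[𝕜] H b
  counit : H 0 →ₐ[𝕜] 𝕜
  antipode (a : G) : H a →ₗ[𝕜] H (-a)
  antipode_bijective (a : G) : Function.Bijective (antipode a)
  coassoc (a b c : G) (x : H (a + b + c)) :
    TensorProduct.assoc 𝕜 (H a) (H b) (H c)
        (TensorProduct.map (comul a b).toLinearMap LinearMap.id (comul (a + b) c x)) =
      TensorProduct.map LinearMap.id (comul b c).toLinearMap
        (comul a (b + c) (gcast 𝕜 H (add_assoc a b c) x))
  id_counit (a : G) (x : H (a + 0)) :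
    TensorProduct.rid 𝕜 (H a)
        (TensorProduct.map LinearMap.id counit.toLinearMap (comul a 0 x)) =
      gcast 𝕜 H (add_zero a) x
  counit_id (a : G) (x : H (0 + a)) :
    TensorProduct.lid 𝕜 (H a)
        (TensorProduct.map counit.toLinearMap LinearMap.id (comul 0 a x)) =
      gcast 𝕜 H (zero_add a) x
  antipode_id (a : G) (x : H 0) :
    LinearMap.mul' 𝕜 (H a)
        (TensorProduct.map ((gcast 𝕜 H (neg_neg a)).toLinearMap ∘ₗ antipode (-a)) LinearMap.id
          (comul (-a) a (gcast 𝕜 H (neg_add_cancel a).symm x))) =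
      algebraMap 𝕜 (H a) (counit x)
  id_antipode (a : G) (x : H 0) :
    LinearMap.mul' 𝕜 (H a)
        (TensorProduct.map LinearMap.id ((gcast 𝕜 H (neg_neg a)).toLinearMap ∘ₗ antipode (-a))
          (comul a (-a) (gcast 𝕜 H (add_neg_cancel a).symm x))) =
      algebraMap 𝕜 (H a) (counit x)

namespace HopfGCoalgebra

/-- `g` is a pivot: a `G`-grouplike element with `S_{-a} S_a (x) = g_a x g_a⁻¹`. -/
structure IsPivot (A : HopfGCoalgebra 𝕜 H) (g : ∀ a, (H a)ˣ) : Prop where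
  comul_eq (a b : G) : A.comul a b (g (a + b) : H (a + b)) = (g a : H a) ⊗ₜ[𝕜] (g b : H b)
  counit_eq : A.counit (g 0 : H 0) = 1
  antipode_antipode (a : G) (x : H a) :
    gcast 𝕜 H (neg_neg a) (A.antipode (-a) (A.antipode a x)) =
      (g a : H a) * x * ((g a)⁻¹ : (H a)ˣ)

/-- `r ⊗ s ↦ r ⊗ s ⊗ 1`. -/
noncomputable def leg12 (𝕜 : Type u) [CommRing 𝕜] (A B C : Type w) [Ring A] [Algebra 𝕜 A]
    [Ring B] [Algebra 𝕜 B] [Ring C] [Algebra 𝕜 C] : A ⊗[𝕜] B →ₐ[𝕜] A ⊗[𝕜] (B ⊗[𝕜] C) :=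
  Algebra.TensorProduct.map (AlgHom.id 𝕜 A) Algebra.TensorProduct.includeLeft

/-- `r ⊗ s ↦ r ⊗ 1 ⊗ s`. -/
noncomputable def leg13 (𝕜 : Type u) [CommRing 𝕜] (A B C : Type w) [Ring A] [Algebra 𝕜 A]
    [Ring B] [Algebra 𝕜 B] [Ring C] [Algebra 𝕜 C] : A ⊗[𝕜] C →ₐ[𝕜] A ⊗[𝕜] (B ⊗[𝕜] C) :=
  Algebra.TensorProduct.map (AlgHom.id 𝕜 A) Algebra.TensorProduct.includeRight

/-- `r ⊗ s ↦ 1 ⊗ r ⊗ s`. -/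
noncomputable def leg23 (𝕜 : Type u) [CommRing 𝕜] (A B C : Type w) [Ring A] [Algebra 𝕜 A]
    [Ring B] [Algebra 𝕜 B] [Ring C] [Algebra 𝕜 C] : B ⊗[𝕜] C →ₐ[𝕜] A ⊗[𝕜] (B ⊗[𝕜] C) :=
  Algebra.TensorProduct.includeRight

/-- `R = {R_{a,b} ∈ H_a ⊗ H_b}` is an R-matrix. -/
structure IsRMatrix (A : HopfGCoalgebra 𝕜 H) (R : ∀ a b, H a ⊗[𝕜] H b) : Prop where
  isUnit (a b : G) : IsUnit (R a b)
  mul_comul (a b : G) (x : H (a + b)) :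
    R a b * A.comul a b x =
      TensorProduct.comm 𝕜 (H b) (H a) (A.comul b a (gcast 𝕜 H (add_comm a b) x)) * R a b
  id_comul (a b c : G) :
    TensorProduct.map LinearMap.id (A.comul b c).toLinearMap (R a (b + c)) =
      leg13 𝕜 (H a) (H b) (H c) (R a c) * leg12 𝕜 (H a) (H b) (H c) (R a b)
  comul_id (a b c : G) :
    TensorProduct.assoc 𝕜 (H a) (H b) (H c)
        (TensorProduct.map (A.comul a b).toLinearMap LinearMap.id (R (a + b) c)) =
      leg13 𝕜 (H a) (H b) (H c) (R a c) * leg23 𝕜 (H a) (H b) (H c) (R b c)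

/-- The Hopf `G`-coalgebra `A` is ribbon with pivot `g` and R-matrix `R`:
`m_a(τ((g_a ⊗ 1) R_{a,a})) = m_a((1 ⊗ g_a⁻¹) R_{a,a})` for all `a`. -/
structure IsRibbon (A : HopfGCoalgebra 𝕜 H) (g : ∀ a, (H a)ˣ) (R : ∀ a b, H a ⊗[𝕜] H b) :
    Prop where
  pivot : A.IsPivot g
  rMatrix : A.IsRMatrix R
  twist (a : G) :
    LinearMap.mul' 𝕜 (H a)
        (TensorProduct.comm 𝕜 (H a) (H a) (((g a : H a) ⊗ₜ[𝕜] (1 : H a)) * R a a)) =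
      LinearMap.mul' 𝕜 (H a) (((1 : H a) ⊗ₜ[𝕜] (((g a)⁻¹ : (H a)ˣ) : H a)) * R a a)

end HopfGCoalgebra

end HopfGCoalgebras

/-! ## Preliminary facts on `q`-commuting elements -/

namespace QCommute

/-- The `q`-integer `1 + q + ⋯ + q^(n-1)`. -/
noncomputable def qint (q : ℂ) (n : ℕ) : ℂ := ∑ i ∈ Finset.range n, q ^ i

/-- The `q`-factorial. -/
noncomputable def qfact (q : ℂ) (n : ℕ) : ℂ := ∏ i ∈ Finset.range n, qint q (i + 1)

/-- Gaussian binomial coefficients. -/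
noncomputable def qbinom (q : ℂ) : ℕ → ℕ → ℂ
  | _, 0 => 1
  | 0, _ + 1 => 0
  | n + 1, k + 1 => qbinom q n k + q ^ (k + 1) * qbinom q n (k + 1)

theorem qbinom_eq_zero (q : ℂ) (n k : ℕ) (h : n < k) : qbinom q n k = 0 := by
  induction n generalizing k with
  | zero => cases k with
    | zero => omega
    | succ k => rfl
  | succ n ih => cases k with
    | zero => omega
    | succ k => simp [qbinom, ih k (by omega), ih (k + 1) (by omega)]

theorem qint_add (q : ℂ) (m n : ℕ) : qint q (m + n) = qint q m + q ^ m * qint q n := by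
  simp [qint, Finset.sum_range_add, Finset.mul_sum, pow_add]

theorem qbinom_mul (q : ℂ) (k j : ℕ) :
    qbinom q (k + j) k * (qfact q k * qfact q j) = qfact q (k + j) := by
  have hs : ∀ n, qfact q (n + 1) = qfact q n * qint q (n + 1) := fun n => by
    simp [qfact, Finset.prod_range_succ]
  have h0 : qfact q 0 = 1 := by simp [qfact]
  have hself : ∀ n, qbinom q n n = 1 := fun n => by
    induction n with
    | zero => rfl
    | succ n ih => simp [qbinom, ih, qbinom_eq_zero q n (n + 1) (by omega)]
  induction hn : k + j generalizing k j with
  | zero =>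
    obtain ⟨rfl, rfl⟩ : k = 0 ∧ j = 0 := by omega
    simp [qbinom, h0]
  | succ n ih =>
    cases k with
    | zero =>
      obtain rfl : j = n + 1 := by omega
      simp [qbinom, h0]
    | succ k =>
      cases j with
      | zero =>
        obtain rfl : k = n := by omega
        simp [hself, h0]
      | succ j =>
        have e1 := ih k (j + 1) (by omega)
        have e2 := ih (k + 1) j (by omega)
        have e3 : qint q (n + 1) = qint q (k + 1) + q ^ (k + 1) * qint q (j + 1) := by
          rw [← qint_add]; congr 1; omega
        simp only [qbinom]
        rw [hs n, e3, hs k, hs j] at *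
        linear_combination qint q (k + 1) * e1 + q ^ (k + 1) * qint q (j + 1) * e2

variable {A : Type*} [Ring A] [Algebra ℂ A]

theorem pow_mul_eq {q : ℂ} {x y : A} (h : y * x = q • (x * y)) (k : ℕ) :
    y * x ^ k = q ^ k • (x ^ k * y) := by
  induction k with
  | zero => simp
  | succ k ih =>
    rw [pow_succ, ← mul_assoc, ih, smul_mul_assoc, mul_assoc, h, mul_smul_comm, smul_smul,
      ← mul_assoc, pow_succ]

theorem add_pow_eq {q : ℂ} {x y : A} (h : y * x = q • (x * y)) (n : ℕ) :
    (x + y) ^ n = ∑ k ∈ Finset.range (n + 1), qbinom q n k • (x ^ k * y ^ (n - k)) := by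
  induction n with
  | zero => simp [qbinom]
  | succ n ih =>
    rw [pow_succ', ih, add_mul, Finset.mul_sum, Finset.mul_sum,
      Finset.sum_range_succ' (fun k => y * qbinom q n k • (x ^ k * y ^ (n - k))) n,
      Finset.sum_range_succ' _ (n + 1)]
    have e1 : ∀ k ∈ Finset.range (n + 1), x * qbinom q n k • (x ^ k * y ^ (n - k)) =
        qbinom q n k • (x ^ (k + 1) * y ^ (n - k)) := fun k _ => by
      rw [mul_smul_comm, ← mul_assoc, ← pow_succ']
    have e2 : ∀ k ∈ Finset.range n, y * qbinom q n (k + 1) • (x ^ (k + 1) * y ^ (n - (k + 1))) =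
        (q ^ (k + 1) * qbinom q n (k + 1)) • (x ^ (k + 1) * y ^ (n - k)) := fun k hk => by
      have : n - k = n - (k + 1) + 1 := by have := Finset.mem_range.1 hk; omega
      rw [mul_smul_comm, ← mul_assoc, pow_mul_eq h, smul_mul_assoc, smul_smul, mul_assoc,
        ← pow_succ', this, mul_comm]
    have e3 : ∀ k ∈ Finset.range (n + 1),
        qbinom q (n + 1) (k + 1) • (x ^ (k + 1) * y ^ (n + 1 - (k + 1))) =
        qbinom q n k • (x ^ (k + 1) * y ^ (n - k)) +
        (q ^ (k + 1) * qbinom q n (k + 1)) • (x ^ (k + 1) * y ^ (n - k)) := fun k _ => by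
      rw [← add_smul, Nat.add_sub_add_right]; rfl
    rw [Finset.sum_congr rfl e3, Finset.sum_add_distrib,
      Finset.sum_range_succ (fun k => (q ^ (k + 1) * qbinom q n (k + 1)) • _) n,
      Finset.sum_congr rfl e1, Finset.sum_congr rfl e2,
      qbinom_eq_zero q n (n + 1) (by omega)]
    simp [qbinom, pow_succ', add_assoc]

theorem add_pow_eq_zero {q : ℂ} {n : ℕ} (hq : IsPrimitiveRoot q n) {x y : A}
    (h : y * x = q • (x * y)) (hx : x ^ n = 0) (hy : y ^ n = 0) : (x + y) ^ n = 0 := by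
  rw [add_pow_eq h]
  refine Finset.sum_eq_zero fun k hk => ?_
  have hk : k ≤ n := Nat.lt_succ_iff.1 (Finset.mem_range.1 hk)
  rcases Nat.eq_zero_or_pos k with rfl | hk0
  · simp [hy]
  rcases hk.eq_or_lt with rfl | hkn
  · simp [hx]
  have hne : ∀ j, 0 < j → j < n → qint q j ≠ 0 := fun j hj hjn h0 => by
    have := hq.pow_ne_one_of_pos_of_lt hj.ne' hjn
    have h1 := mul_geom_sum q j
    rw [show ∑ i ∈ Finset.range j, q ^ i = 0 from h0, mul_zero] at h1
    exact this (sub_eq_zero.1 h1.symm)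
  have hne' : ∀ j, j < n → qfact q j ≠ 0 := fun j hj =>
    Finset.prod_ne_zero_iff.2 fun i hi =>
      hne _ (by omega) (by have := Finset.mem_range.1 hi; omega)
  have hz : qfact q n = 0 := by
    refine Finset.prod_eq_zero (i := n - 1) (Finset.mem_range.2 (by omega)) ?_
    rw [show n - 1 + 1 = n by omega]
    exact hq.geom_sum_eq_zero (by omega)
  have := qbinom_mul q k (n - k)
  rw [show k + (n - k) = n by omega, hz] at this
  have hb : qbinom q n k = 0 :=
    (mul_eq_zero.1 this).resolve_right (mul_ne_zero (hne' _ hkn) (hne' _ (by omega)))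
  rw [hb, zero_smul]

theorem mul_pow_eq_zero {q : ℂ} {n : ℕ} {x y : A} (h : y * x = q • (x * y)) (hx : x ^ n = 0) :
    (x * y) ^ n = 0 := by
  have : ∀ k, ∃ c : ℂ, (x * y) ^ k = c • (x ^ k * y ^ k) := fun k => by
    induction k with
    | zero => exact ⟨1, by simp⟩
    | succ k ih =>
      obtain ⟨c, hc⟩ := ih
      refine ⟨q ^ k * c, ?_⟩
      rw [pow_succ', hc, mul_smul_comm, mul_assoc, ← mul_assoc y, pow_mul_eq h, smul_mul_assoc,
        mul_smul_comm, smul_smul, mul_comm c, pow_succ' x, pow_succ' y]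
      simp only [mul_assoc]
  obtain ⟨c, hc⟩ := this n
  rw [hc, hx, zero_mul, smul_zero]

end QCommute

/-! ## The quantum group and its quotients -/

namespace QuantumSl2

/-- `ℓ' = ℓ / gcd(ℓ, 2)`. -/
def ell' (ℓ : ℕ) : ℕ := ℓ / Nat.gcd ℓ 2

/-- `ξ^x = exp(2πi x / ℓ)`. -/
noncomputable def xi (ℓ : ℕ) (x : ℂ) : ℂ := Complex.exp (2 * Real.pi * Complex.I * x / ℓ)

/-- `{x} = ξ^x - ξ^{-x}`. -/
noncomputable def qn (ℓ : ℕ) (x : ℂ) : ℂ := xi ℓ x - xi ℓ (-x)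

/-- `{n}! = {n}{n-1}⋯{1}`. -/
noncomputable def qnFactorial (ℓ n : ℕ) : ℂ := ∏ i ∈ Finset.range n, qn ℓ (i + 1)

theorem xi_zero (ℓ : ℕ) : xi ℓ 0 = 1 := by simp [xi]

theorem xi_add (ℓ : ℕ) (x y : ℂ) : xi ℓ (x + y) = xi ℓ x * xi ℓ y := by
  rw [xi, xi, xi, ← Complex.exp_add]; ring_nf

theorem xi_mul_neg (ℓ : ℕ) (x : ℂ) : xi ℓ x * xi ℓ (-x) = 1 := by
  rw [← xi_add, add_neg_cancel, xi_zero]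

theorem isPrimitiveRoot_xi_two {ℓ : ℕ} (h : ℓ ≠ 0) : IsPrimitiveRoot (xi ℓ 2) (ell' ℓ) := by
  have h1 := Complex.isPrimitiveRoot_exp ℓ h
  have h2 : xi ℓ 2 = Complex.exp (2 * Real.pi * Complex.I / ℓ) ^ 2 := by
    rw [← Complex.exp_nat_mul, xi]; congr 1; push_cast; ring
  have h3 := IsPrimitiveRoot.orderOf (xi ℓ 2)
  rwa [h2, orderOf_pow' _ (by norm_num : (2 : ℕ) ≠ 0), ← h1.eq_orderOf, ← h2] at h3

/-- Generators `E`, `F` and `K^α`, `α ∈ ℂ`. -/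
inductive Gen : Type
  | E : Gen
  | F : Gen
  | K (α : ℂ) : Gen

namespace Free

abbrev E : FreeAlgebra ℂ Gen := FreeAlgebra.ι ℂ Gen.E
abbrev F : FreeAlgebra ℂ Gen := FreeAlgebra.ι ℂ Gen.F
abbrev K (α : ℂ) : FreeAlgebra ℂ Gen := FreeAlgebra.ι ℂ (Gen.K α)

end Free

/-- The defining relations of `𝒰^K`. -/
inductive UKRel (ℓ : ℕ) : FreeAlgebra ℂ Gen → FreeAlgebra ℂ Gen → Prop
  | K_mul (α β : ℂ) : UKRel ℓ (Free.K α * Free.K β) (Free.K (α + β))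
  | K_zero : UKRel ℓ (Free.K 0) 1
  | K_E (α : ℂ) : UKRel ℓ (Free.K α * Free.E * Free.K (-α)) (xi ℓ (2 * α) • Free.E)
  | K_F (α : ℂ) : UKRel ℓ (Free.K α * Free.F * Free.K (-α)) (xi ℓ (-2 * α) • Free.F)
  | E_F : UKRel ℓ (Free.E * Free.F - Free.F * Free.E)
      ((xi ℓ 1 - xi ℓ (-1))⁻¹ • (Free.K 1 - Free.K (-1)))
  | E_pow : UKRel ℓ (Free.E ^ ell' ℓ) 0
  | F_pow : UKRel ℓ (Free.F ^ ell' ℓ) 0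

/-- The algebra `𝒰^K`. -/
def UK (ℓ : ℕ) : Type := RingQuot (UKRel ℓ)

noncomputable instance (ℓ : ℕ) : Ring (UK ℓ) := inferInstanceAs (Ring (RingQuot (UKRel ℓ)))

noncomputable instance (ℓ : ℕ) : Algebra ℂ (UK ℓ) :=
  inferInstanceAs (Algebra ℂ (RingQuot (UKRel ℓ)))

namespace UK

variable {ℓ : ℕ}

/-- The projection from the free algebra. -/
noncomputable def mk (ℓ : ℕ) : FreeAlgebra ℂ Gen →ₐ[ℂ] UK ℓ := RingQuot.mkAlgHom ℂ (UKRel ℓ)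

theorem mk_surjective : Function.Surjective (mk ℓ) := RingQuot.mkAlgHom_surjective ℂ _

noncomputable def E (ℓ : ℕ) : UK ℓ := mk ℓ Free.E
noncomputable def F (ℓ : ℕ) : UK ℓ := mk ℓ Free.F
noncomputable def K (ℓ : ℕ) (α : ℂ) : UK ℓ := mk ℓ (Free.K α)

/-- Elements `e`, `f`, `k α` of an algebra satisfying the relations of `𝒰^K`. -/
structure Sat (ℓ : ℕ) {B : Type*} [Ring B] [Algebra ℂ B] (e f : B) (k : ℂ → B) : Prop where
  k_mul (α β : ℂ) : k α * k β = k (α + β)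
  k_zero : k 0 = 1
  k_e (α : ℂ) : k α * e = xi ℓ (2 * α) • (e * k α)
  k_f (α : ℂ) : k α * f = xi ℓ (-2 * α) • (f * k α)
  e_f : e * f - f * e = (xi ℓ 1 - xi ℓ (-1))⁻¹ • (k 1 - k (-1))
  e_pow : e ^ ell' ℓ = 0
  f_pow : f ^ ell' ℓ = 0

section Sat

variable {B : Type*} [Ring B] [Algebra ℂ B] {e f : B} {k : ℂ → B}

theorem Sat.k_neg (h : Sat ℓ e f k) (α : ℂ) : k α * k (-α) = 1 := by
  rw [h.k_mul, add_neg_cancel, h.k_zero]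

theorem Sat.k_neg' (h : Sat ℓ e f k) (α : ℂ) : k (-α) * k α = 1 := by
  rw [h.k_mul, neg_add_cancel, h.k_zero]

theorem Sat.map (h : Sat ℓ e f k) {C : Type*} [Ring C] [Algebra ℂ C] (φ : B →ₐ[ℂ] C) :
    Sat ℓ (φ e) (φ f) (fun α => φ (k α)) where
  k_mul α β := by rw [← map_mul, h.k_mul]
  k_zero := by rw [h.k_zero, map_one]
  k_e α := by rw [← map_mul, h.k_e, map_smul, map_mul]
  k_f α := by rw [← map_mul, h.k_f, map_smul, map_mul]
  e_f := by rw [← map_mul, ← map_mul, ← map_sub, h.e_f, map_smul, map_sub]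
  e_pow := by rw [← map_pow, h.e_pow, map_zero]
  f_pow := by rw [← map_pow, h.f_pow, map_zero]

/-- The algebra map out of `𝒰^K` with prescribed values on generators. -/
noncomputable def lift (h : Sat ℓ e f k) : UK ℓ →ₐ[ℂ] B :=
  RingQuot.liftAlgHom ℂ
    ⟨FreeAlgebra.lift ℂ (fun x : Gen => match x with
      | .E => e
      | .F => f
      | .K α => k α), by
      intro x y hxy
      cases hxy with
      | K_mul α β => simpa using h.k_mul α β
      | K_zero => simpa using h.k_zero
      | K_E α =>
        have : k α * e * k (-α) = xi ℓ (2 * α) • e := by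
          rw [h.k_e, smul_mul_assoc, mul_assoc, h.k_neg, mul_one]
        simpa using this
      | K_F α =>
        have : k α * f * k (-α) = xi ℓ (-2 * α) • f := by
          rw [h.k_f, smul_mul_assoc, mul_assoc, h.k_neg, mul_one]
        simpa using this
      | E_F => simpa using h.e_f
      | E_pow => simpa using h.e_pow
      | F_pow => simpa using h.f_pow⟩

theorem lift_mk (h : Sat ℓ e f k) (x : FreeAlgebra ℂ Gen) :
    lift h (mk ℓ x) = FreeAlgebra.lift ℂ (fun x : Gen => match x with
      | .E => e
      | .F => f
      | .K α => k α) x :=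
  RingQuot.liftAlgHom_mkAlgHom_apply ℂ _ _ x

@[simp] theorem lift_E (h : Sat ℓ e f k) : lift h (E ℓ) = e := by simp [E, lift_mk]
@[simp] theorem lift_F (h : Sat ℓ e f k) : lift h (F ℓ) = f := by simp [F, lift_mk]
@[simp] theorem lift_K (h : Sat ℓ e f k) (α : ℂ) : lift h (K ℓ α) = k α := by simp [K, lift_mk]

end Sat

theorem sat (ℓ : ℕ) : Sat ℓ (E ℓ) (F ℓ) (K ℓ) := by
  have rel : ∀ {x y}, UKRel ℓ x y → mk ℓ x = mk ℓ y := fun h => RingQuot.mkAlgHom_rel ℂ h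
  have hK : ∀ α β, K ℓ α * K ℓ β = K ℓ (α + β) := fun α β => by
    simpa [K] using rel (.K_mul α β)
  have h0 : K ℓ 0 = 1 := by simpa [K] using rel .K_zero
  have hn : ∀ α, K ℓ (-α) * K ℓ α = 1 := fun α => by rw [hK, neg_add_cancel, h0]
  refine ⟨hK, h0, fun α => ?_, fun α => ?_, ?_, ?_, ?_⟩
  · have : K ℓ α * E ℓ * K ℓ (-α) = xi ℓ (2 * α) • E ℓ := by
      simpa [K, E] using rel (.K_E α)
    rw [← smul_mul_assoc, ← this, mul_assoc _ (K ℓ (-α)), hn, mul_one]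
  · have : K ℓ α * F ℓ * K ℓ (-α) = xi ℓ (-2 * α) • F ℓ := by
      simpa [K, F] using rel (.K_F α)
    rw [← smul_mul_assoc, ← this, mul_assoc _ (K ℓ (-α)), hn, mul_one]
  · simpa [K, E, F] using rel .E_F
  · simpa [E] using rel .E_pow
  · simpa [F] using rel .F_pow

theorem induction {p : UK ℓ → Prop} (algebraMap : ∀ c, p (algebraMap ℂ _ c)) (E : p (E ℓ))
    (F : p (F ℓ)) (K : ∀ α, p (K ℓ α)) (add : ∀ x y, p x → p y → p (x + y))
    (mul : ∀ x y, p x → p y → p (x * y)) (x : UK ℓ) : p x := by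
  obtain ⟨x, rfl⟩ := mk_surjective x
  induction x with
  | grade0 c => rw [AlgHom.commutes]; exact algebraMap c
  | grade1 g => cases g with
    | E => exact E
    | F => exact F
    | K α => exact K α
  | add x y hx hy => rw [map_add]; exact add _ _ hx hy
  | mul x y hx hy => rw [map_mul]; exact mul _ _ hx hy

section Comul

variable {B C : Type*} [Ring B] [Algebra ℂ B] [Ring C] [Algebra ℂ C]
  {e f : B} {k : ℂ → B} {e' f' : C} {k' : ℂ → C}

theorem Sat.tensor (h : Sat ℓ e f k) (h' : Sat ℓ e' f' k') :
    Sat ℓ ((1 : B) ⊗ₜ[ℂ] e' + e ⊗ₜ[ℂ] k' 1) (k (-1) ⊗ₜ[ℂ] f' + f ⊗ₜ[ℂ] (1 : C))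
      (fun α => k α ⊗ₜ[ℂ] k' α) where
  k_mul α β := by simp [h.k_mul, h'.k_mul]
  k_zero := by simp [h.k_zero, h'.k_zero, Algebra.TensorProduct.one_def]
  k_e α := by
    simp [mul_add, add_mul, h.k_e, h'.k_e, h'.k_mul, TensorProduct.tmul_smul,
      TensorProduct.smul_tmul', add_comm]
  k_f α := by
    have h1 := h.k_f α
    have h2 := h'.k_f α
    simp only [neg_mul] at h1 h2
    simp [mul_add, add_mul, h1, h2, h.k_mul, TensorProduct.tmul_smul,
      TensorProduct.smul_tmul', add_comm]
  e_f := by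
    have e1 := h.e_f
    have e2 := h'.e_f
    have e3 := h.k_e (-1)
    have e4 := h'.k_f 1
    have e5 : xi ℓ (2 * -1) = xi ℓ (-2 * 1) := by norm_num
    rw [sub_eq_iff_eq_add] at e1 e2
    simp only [mul_add, add_mul, Algebra.TensorProduct.tmul_mul_tmul, one_mul, mul_one, e1, e2, e3,
      e4, e5, TensorProduct.tmul_add, TensorProduct.add_tmul, TensorProduct.tmul_smul,
      TensorProduct.smul_tmul', TensorProduct.tmul_sub, TensorProduct.sub_tmul, smul_sub]
    abel
  e_pow := by
    rcases eq_or_ne ℓ 0 with rfl | hℓ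
    · have : (1 : B ⊗[ℂ] C) = 0 := by
        have := h.e_pow
        simp only [ell', Nat.zero_div, pow_zero] at this
        rw [Algebra.TensorProduct.one_def, this, TensorProduct.zero_tmul]
      rw [← one_mul (_ ^ _), this, zero_mul]
    refine QCommute.add_pow_eq_zero (isPrimitiveRoot_xi_two hℓ) ?_ ?_ ?_
    · simp [h'.k_e, TensorProduct.tmul_smul]
    · simp [h'.e_pow]
    · simp [h.e_pow]
  f_pow := by
    rcases eq_or_ne ℓ 0 with rfl | hℓ
    · have : (1 : B ⊗[ℂ] C) = 0 := by
        have := h.e_pow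
        simp only [ell', Nat.zero_div, pow_zero] at this
        rw [Algebra.TensorProduct.one_def, this, TensorProduct.zero_tmul]
      rw [← one_mul (_ ^ _), this, zero_mul]
    rw [add_comm]
    refine QCommute.add_pow_eq_zero (isPrimitiveRoot_xi_two hℓ) ?_ ?_ ?_
    · simp [h.k_f, TensorProduct.smul_tmul']
    · simp [h.f_pow]
    · simp [h'.f_pow]

/-- The relations satisfied by the antipodes of the generators, in the opposite algebra. -/
theorem Sat.op (h : Sat ℓ e f k) :
    Sat ℓ (MulOpposite.op (-(e * k (-1)))) (MulOpposite.op (-(k 1 * f)))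
      (fun α => MulOpposite.op (k (-α))) where
  k_mul α β := by simp [← MulOpposite.op_mul, h.k_mul, add_comm]
  k_zero := by simp [h.k_zero]
  k_e α := by
    rw [← MulOpposite.op_mul, ← MulOpposite.op_mul, ← MulOpposite.op_smul]
    congr 1
    have := h.k_e (-α)
    rw [mul_neg, neg_mul, smul_neg, ← mul_assoc, this, smul_mul_assoc, smul_smul, mul_neg,
      xi_mul_neg, one_smul, mul_assoc, mul_assoc, h.k_mul, h.k_mul, add_comm]
  k_f α := by
    rw [← MulOpposite.op_mul, ← MulOpposite.op_mul, ← MulOpposite.op_smul]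
    congr 1
    have := h.k_f (-α)
    rw [mul_neg, neg_mul, smul_neg, ← mul_assoc, h.k_mul, add_comm, ← h.k_mul, mul_assoc,
      mul_assoc (k 1) (k (-α)), this, mul_smul_comm, smul_smul, show -2 * -α = -(-2 * α) by ring, xi_mul_neg, one_smul]
  e_f := by
    rw [← MulOpposite.op_mul, ← MulOpposite.op_mul, ← MulOpposite.op_sub, ← MulOpposite.op_sub,
      ← MulOpposite.op_smul]
    congr 1
    have e1 : k 1 * f * (e * k (-1)) = f * e := by
      rw [h.k_f 1, smul_mul_assoc, mul_assoc f, ← mul_assoc (k 1), h.k_e 1, smul_mul_assoc,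
        mul_assoc, h.k_neg, mul_one e, mul_smul_comm, smul_smul, show -2 * (1 : ℂ) = -(2 * 1) by ring,
        mul_comm (xi ℓ _), xi_mul_neg, one_smul]
    have e2 : e * k (-1) * (k 1 * f) = e * f := by
      rw [mul_assoc, ← mul_assoc (k (-1)), h.k_neg', one_mul]
    rw [neg_mul_neg, neg_mul_neg, e1, e2, neg_neg, ← neg_sub, h.e_f, ← smul_neg, neg_sub]
  e_pow := by
    rw [← MulOpposite.op_pow, neg_pow, QCommute.mul_pow_eq_zero (h.k_e _) h.e_pow, mul_zero,
      MulOpposite.op_zero]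
  f_pow := by
    have : k 1 * f = f * (xi ℓ (-2 * 1) • k 1) := by rw [h.k_f, mul_smul_comm]
    rw [← MulOpposite.op_pow, neg_pow, this, QCommute.mul_pow_eq_zero (q := xi ℓ (-2 * 1)) ?_
      h.f_pow, mul_zero, MulOpposite.op_zero]
    rw [smul_mul_assoc, h.k_f, mul_smul_comm]

theorem sat_counit (hℓ : 3 ≤ ℓ) : Sat ℓ (0 : ℂ) 0 (fun _ => 1) := by
  have : ell' ℓ ≠ 0 := by
    have h1 : Nat.gcd ℓ 2 ≤ 2 := Nat.gcd_le_right _ (by norm_num)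
    have h2 : 0 < Nat.gcd ℓ 2 := Nat.gcd_pos_of_pos_right _ (by norm_num)
    exact (Nat.div_pos (by omega) h2).ne'
  exact ⟨by simp, rfl, by simp, by simp, by simp, zero_pow this, zero_pow this⟩

end Comul

/-- `Δ(E) = 1 ⊗ E + E ⊗ K`, `Δ(F) = K⁻¹ ⊗ F + F ⊗ 1`, `Δ(K^α) = K^α ⊗ K^α`. -/
noncomputable def comul (ℓ : ℕ) : UK ℓ →ₐ[ℂ] UK ℓ ⊗[ℂ] UK ℓ :=
  lift (e := 1 ⊗ₜ E ℓ + E ℓ ⊗ₜ K ℓ 1) (f := K ℓ (-1) ⊗ₜ F ℓ + F ℓ ⊗ₜ 1)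
    (k := fun α => K ℓ α ⊗ₜ K ℓ α) ((sat ℓ).tensor (sat ℓ))

/-- `ε(E) = 0`, `ε(F) = 0`, `ε(K^α) = 1`. -/
noncomputable def counit (hℓ : 3 ≤ ℓ) : UK ℓ →ₐ[ℂ] ℂ :=
  lift (e := 0) (f := 0) (k := fun _ => 1) (sat_counit hℓ)

/-- `S(E) = -E K⁻¹`, `S(F) = -K F`, `S(K^α) = K^{-α}`, as an algebra map to the opposite
algebra. -/
noncomputable def antipode (ℓ : ℕ) : UK ℓ →ₐ[ℂ] (UK ℓ)ᵐᵒᵖ :=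
  lift (e := MulOpposite.op (-(E ℓ * K ℓ (-1)))) (f := MulOpposite.op (-(K ℓ 1 * F ℓ)))
    (k := fun α => MulOpposite.op (K ℓ (-α))) (sat ℓ).op

end UK

/-- The grading group `G = ℂ / 2ℤ`. -/
abbrev G : Type := ℂ ⧸ AddSubgroup.zmultiples (2 : ℂ)

/-- The relation `K^{ℓ/2} = ξ^{ℓa/2}`; the scalar is the same for all lifts `z ∈ ℂ` of `a`. -/
inductive URel (ℓ : ℕ) (a : G) : UK ℓ → UK ℓ → Prop
  | K_half (z : ℂ) (hz : (z : G) = a) :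
      URel ℓ a (UK.K ℓ ((ℓ : ℂ) / 2)) (algebraMap ℂ (UK ℓ) (xi ℓ ((ℓ : ℂ) * z / 2)))

/-- `U_a = 𝒰^K / (K^{ℓ/2} - ξ^{ℓa/2})`. -/
def U (ℓ : ℕ) (a : G) : Type := RingQuot (URel ℓ a)

noncomputable instance (ℓ : ℕ) (a : G) : Ring (U ℓ a) :=
  inferInstanceAs (Ring (RingQuot (URel ℓ a)))

noncomputable instance (ℓ : ℕ) (a : G) : Algebra ℂ (U ℓ a) :=
  inferInstanceAs (Algebra ℂ (RingQuot (URel ℓ a)))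

namespace U

variable {ℓ : ℕ}

/-- The projection `𝒰^K → U_a`. -/
noncomputable def proj (ℓ : ℕ) (a : G) : UK ℓ →ₐ[ℂ] U ℓ a := RingQuot.mkAlgHom ℂ (URel ℓ a)

theorem proj_surjective (a : G) : Function.Surjective (proj ℓ a) :=
  RingQuot.mkAlgHom_surjective ℂ _

noncomputable def E (ℓ : ℕ) (a : G) : U ℓ a := proj ℓ a (UK.E ℓ)
noncomputable def F (ℓ : ℕ) (a : G) : U ℓ a := proj ℓ a (UK.F ℓ)
noncomputable def K (ℓ : ℕ) (a : G) (α : ℂ) : U ℓ a := proj ℓ a (UK.K ℓ α)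

theorem sat (ℓ : ℕ) (a : G) : UK.Sat ℓ (E ℓ a) (F ℓ a) (K ℓ a) := (UK.sat ℓ).map (proj ℓ a)

theorem K_half (a : G) (z : ℂ) (hz : (z : G) = a) :
    K ℓ a ((ℓ : ℂ) / 2) = algebraMap ℂ _ (xi ℓ ((ℓ : ℂ) * z / 2)) := by
  rw [← (proj ℓ a).commutes]
  exact RingQuot.mkAlgHom_rel ℂ (URel.K_half z hz)

/-- The algebra map out of `U_a` induced by one out of `𝒰^K`. -/
noncomputable def lift {a : G} {B : Type*} [Ring B] [Algebra ℂ B] (φ : UK ℓ →ₐ[ℂ] B)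
    (h : ∀ z : ℂ, (z : G) = a →
      φ (UK.K ℓ ((ℓ : ℂ) / 2)) = algebraMap ℂ B (xi ℓ ((ℓ : ℂ) * z / 2))) : U ℓ a →ₐ[ℂ] B :=
  RingQuot.liftAlgHom ℂ ⟨φ, by rintro _ _ ⟨z, hz⟩; rw [h z hz, φ.commutes]⟩

theorem lift_proj {a : G} {B : Type*} [Ring B] [Algebra ℂ B] (φ : UK ℓ →ₐ[ℂ] B) (h) (x : UK ℓ) :
    lift (a := a) φ h (proj ℓ a x) = φ x :=
  RingQuot.liftAlgHom_mkAlgHom_apply ℂ _ _ x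

theorem induction {a : G} {p : U ℓ a → Prop} (algebraMap : ∀ c, p (algebraMap ℂ _ c))
    (E : p (E ℓ a)) (F : p (F ℓ a)) (K : ∀ α, p (K ℓ a α))
    (add : ∀ x y, p x → p y → p (x + y)) (mul : ∀ x y, p x → p y → p (x * y)) (x : U ℓ a) :
    p x := by
  obtain ⟨x, rfl⟩ := proj_surjective a x
  induction x using UK.induction with
  | algebraMap c => rw [AlgHom.commutes]; exact algebraMap c
  | E => exact E
  | F => exact F
  | K α => exact K α
  | add x y hx hy => rw [map_add]; exact add _ _ hx hy
  | mul x y hx hy => rw [map_mul]; exact mul _ _ hx hy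

theorem hom_ext {a : G} {B : Type*} [Ring B] [Algebra ℂ B] {φ ψ : U ℓ a →ₐ[ℂ] B}
    (hE : φ (E ℓ a) = ψ (E ℓ a)) (hF : φ (F ℓ a) = ψ (F ℓ a))
    (hK : ∀ α, φ (K ℓ a α) = ψ (K ℓ a α)) : φ = ψ := by
  ext x
  induction x using U.induction with
  | algebraMap c => simp
  | E => exact hE
  | F => exact hF
  | K α => exact hK α
  | add x y hx hy => rw [map_add, map_add, hx, hy]
  | mul x y hx hy => rw [map_mul, map_mul, hx, hy]

@[simp] theorem gcast_E {a b : G} (h : a = b) : gcast ℂ (U ℓ) h (E ℓ a) = E ℓ b := by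
  subst h; rfl
@[simp] theorem gcast_F {a b : G} (h : a = b) : gcast ℂ (U ℓ) h (F ℓ a) = F ℓ b := by
  subst h; rfl
@[simp] theorem gcast_K {a b : G} (h : a = b) (α : ℂ) :
    gcast ℂ (U ℓ) h (K ℓ a α) = K ℓ b α := by
  subst h; rfl

/-- The coproduct `U_{a+b} → U_a ⊗ U_b` induced by that of `𝒰^K`. -/
noncomputable def comul (ℓ : ℕ) (a b : G) : U ℓ (a + b) →ₐ[ℂ] U ℓ a ⊗[ℂ] U ℓ b :=
  lift ((Algebra.TensorProduct.map (proj ℓ a) (proj ℓ b)).comp (UK.comul ℓ)) (by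
    intro z hz
    obtain ⟨x, hx⟩ := QuotientAddGroup.mk_surjective a
    have hy : ((z - x : ℂ) : G) = b := by
      rw [QuotientAddGroup.mk_sub, hz, hx, add_sub_cancel_left]
    have h1 := K_half (ℓ := ℓ) a x hx
    have h2 := K_half (ℓ := ℓ) b (z - x) hy
    simp only [K] at h1 h2
    rw [AlgHom.comp_apply, UK.comul, UK.lift_K, Algebra.TensorProduct.map_tmul, h1, h2,
      show (ℓ : ℂ) * z / 2 = ℓ * x / 2 + ℓ * (z - x) / 2 by ring, xi_add, map_mul,
      Algebra.TensorProduct.algebraMap_apply, Algebra.TensorProduct.algebraMap_apply',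
      Algebra.TensorProduct.tmul_mul_tmul, mul_one, one_mul])

/-- The counit `U_0 → ℂ` induced by that of `𝒰^K`. -/
noncomputable def counit (hℓ : 3 ≤ ℓ) : U ℓ 0 →ₐ[ℂ] ℂ :=
  lift (UK.counit hℓ) (by
    intro z hz
    have hℓ0 : (ℓ : ℂ) ≠ 0 := by exact_mod_cast (by omega : ℓ ≠ 0)
    obtain ⟨n, hn⟩ := AddSubgroup.mem_zmultiples_iff.1 ((QuotientAddGroup.eq_zero_iff z).1 hz)
    rw [UK.counit, UK.lift_K, Algebra.algebraMap_self_apply, eq_comm, xi, Complex.exp_eq_one_iff]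
    refine ⟨n, ?_⟩
    rw [← hn, zsmul_eq_mul]
    field_simp)

/-- The antipode as an algebra map `U_a → (U_{-a})ᵒᵖ`, induced by that of `𝒰^K`. -/
noncomputable def antipodeHom (ℓ : ℕ) (a : G) : U ℓ a →ₐ[ℂ] (U ℓ (-a))ᵐᵒᵖ :=
  lift ((AlgHom.op (proj ℓ (-a))).comp (UK.antipode ℓ)) (by
    intro z hz
    have h1 := K_half (ℓ := ℓ) (-a) (-z) (by rw [QuotientAddGroup.mk_neg, hz])
    have h2 := UK.Sat.k_neg' (sat ℓ (-a)) ((ℓ : ℂ) / 2)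
    have h3 := xi_mul_neg ℓ ((ℓ : ℂ) * z / 2)
    rw [h1, show (ℓ : ℂ) * -z / 2 = -(ℓ * z / 2) by ring] at h2
    have h4 : K ℓ (-a) (-((ℓ : ℂ) / 2)) = algebraMap ℂ _ (xi ℓ ((ℓ : ℂ) * z / 2)) := by
      calc _ = K ℓ (-a) (-((ℓ : ℂ) / 2)) *
            algebraMap ℂ _ (xi ℓ (-((ℓ : ℂ) * z / 2)) * xi ℓ ((ℓ : ℂ) * z / 2)) := by
            rw [mul_comm, h3, map_one, mul_one]
        _ = _ := by rw [map_mul, ← mul_assoc, h2, one_mul]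
    rw [AlgHom.comp_apply, UK.antipode, UK.lift_K]
    exact congrArg MulOpposite.op h4)

/-- The antipode `S_a : U_a → U_{-a}`. -/
noncomputable def antipode (ℓ : ℕ) (a : G) : U ℓ a →ₗ[ℂ] U ℓ (-a) :=
  (MulOpposite.opLinearEquiv ℂ).symm.toLinearMap ∘ₗ (antipodeHom ℓ a).toLinearMap

section simps

variable (a b : G)

@[simp] theorem comul_E : comul ℓ a b (E ℓ _) = 1 ⊗ₜ E ℓ b + E ℓ a ⊗ₜ K ℓ b 1 := by
  simp [comul, E, K, lift_proj, UK.comul]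
@[simp] theorem comul_F : comul ℓ a b (F ℓ _) = K ℓ a (-1) ⊗ₜ F ℓ b + F ℓ a ⊗ₜ 1 := by
  simp [comul, F, K, lift_proj, UK.comul]
@[simp] theorem comul_K (α : ℂ) : comul ℓ a b (K ℓ _ α) = K ℓ a α ⊗ₜ K ℓ b α := by
  simp [comul, K, lift_proj, UK.comul]
@[simp] theorem counit_E (hℓ : 3 ≤ ℓ) : counit hℓ (E ℓ 0) = 0 := by
  simp [counit, E, lift_proj, UK.counit]
@[simp] theorem counit_F (hℓ : 3 ≤ ℓ) : counit hℓ (F ℓ 0) = 0 := by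
  simp [counit, F, lift_proj, UK.counit]
@[simp] theorem counit_K (hℓ : 3 ≤ ℓ) (α : ℂ) : counit hℓ (K ℓ 0 α) = 1 := by
  simp [counit, K, lift_proj, UK.counit]
@[simp] theorem antipode_E : antipode ℓ a (E ℓ a) = -(E ℓ (-a) * K ℓ (-a) (-1)) := by
  simp [antipode, antipodeHom, E, K, lift_proj, UK.antipode]
@[simp] theorem antipode_F : antipode ℓ a (F ℓ a) = -(K ℓ (-a) 1 * F ℓ (-a)) := by
  simp [antipode, antipodeHom, F, K, lift_proj, UK.antipode]
@[simp] theorem antipode_K (α : ℂ) : antipode ℓ a (K ℓ a α) = K ℓ (-a) (-α) := by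
  simp [antipode, antipodeHom, K, lift_proj, UK.antipode]
@[simp] theorem antipode_algebraMap (c : ℂ) :
    antipode ℓ a (algebraMap ℂ _ c) = algebraMap ℂ _ c := by
  simp [antipode]
@[simp] theorem antipode_one : antipode ℓ a 1 = 1 := by
  simp [antipode]
@[simp] theorem antipode_mul (x y : U ℓ a) :
    antipode ℓ a (x * y) = antipode ℓ a y * antipode ℓ a x := by
  simp [antipode]

end simps

/-- `S_{-a} S_a` is conjugation by `K`. -/
theorem antipode_antipode (a : G) (x : U ℓ a) :
    gcast ℂ (U ℓ) (neg_neg a) (antipode ℓ (-a) (antipode ℓ a x)) =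
      K ℓ a 1 * x * K ℓ a (-1) := by
  have hs := sat ℓ a
  have h1 := hs.k_neg 1
  have h2 := hs.k_neg' 1
  induction x using U.induction with
  | algebraMap c => rw [← Algebra.commutes, mul_assoc, h1]; simp
  | E =>
    simp only [antipode_E, map_neg, antipode_mul, antipode_K, neg_neg, map_mul, gcast_E, gcast_K]
    noncomm_ring
  | F =>
    simp only [antipode_F, map_neg, antipode_mul, antipode_K, map_mul, gcast_F, gcast_K]
    noncomm_ring
  | K α => simp [hs.k_mul]
  | add x y hx hy => simp [hx, hy, mul_add, add_mul]
  | mul x y hx hy =>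
    rw [antipode_mul, antipode_mul, map_mul, hx, hy]
    simp only [mul_assoc]
    rw [← mul_assoc (K ℓ a (-1)), h2, one_mul]

theorem antipode_bijective (a : G) : Function.Bijective (antipode ℓ a) := by
  have key : ∀ a : G, Function.Bijective (fun x => antipode ℓ (-a) (antipode ℓ a x)) := by
    intro a
    have h1 := (sat ℓ a).k_neg 1
    have h2 := (sat ℓ a).k_neg' 1
    have : Function.Bijective (fun x => K ℓ a 1 * x * K ℓ a (-1)) := by
      refine Function.bijective_iff_has_inverse.2 ⟨fun x => K ℓ a (-1) * x * K ℓ a 1, ?_, ?_⟩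
      · intro x
        simp only [mul_assoc, h2, mul_one]
        rw [← mul_assoc, h2, one_mul]
      · intro x
        simp only [mul_assoc, h1, mul_one]
        rw [← mul_assoc, h1, one_mul]
    simp only [← antipode_antipode] at this
    exact (gcast ℂ (U ℓ) (neg_neg a)).bijective.of_comp_iff' _ |>.1 this
  refine ⟨(key a).1.of_comp (f := antipode ℓ (-a)), ?_⟩
  have h := (key (-a)).2.of_comp (f := antipode ℓ (- -a)) (g := antipode ℓ (-a))
  rwa [neg_neg] at h

/-- If `m(S ⊗ id)(s) = c`, then `m(S ⊗ id)(s t) = c m(S ⊗ id)(t)`, for `S` antimultiplicative. -/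
theorem mul_map_left {A B : Type*} [Ring A] [Algebra ℂ A] [Ring B] [Algebra ℂ B] (S : A →ₗ[ℂ] B)
    (hS : ∀ x y, S (x * y) = S y * S x) (s t : A ⊗[ℂ] B) (c : ℂ)
    (hs : LinearMap.mul' ℂ B (TensorProduct.map S LinearMap.id s) = algebraMap ℂ B c) :
    LinearMap.mul' ℂ B (TensorProduct.map S LinearMap.id (s * t)) =
      algebraMap ℂ B c * LinearMap.mul' ℂ B (TensorProduct.map S LinearMap.id t) := by
  induction t with
  | zero => simp
  | add x y hx hy => rw [mul_add, map_add, map_add, hx, hy, map_add, map_add, mul_add]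
  | tmul y z =>
    have : ∀ s : A ⊗[ℂ] B, LinearMap.mul' ℂ B (TensorProduct.map S LinearMap.id (s * y ⊗ₜ z)) =
        S y * LinearMap.mul' ℂ B (TensorProduct.map S LinearMap.id s) * z := fun s => by
      induction s with
      | zero => simp
      | add u v hu hv =>
        rw [add_mul, map_add, map_add, hu, hv, map_add, map_add, mul_add, add_mul]
      | tmul u v => simp [hS, mul_assoc]
    rw [this, hs, ← Algebra.commutes]
    simp [mul_assoc]

theorem mul_map_right {A B : Type*} [Ring A] [Algebra ℂ A] [Ring B] [Algebra ℂ B] (S : A →ₗ[ℂ] B)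
    (hS : ∀ x y, S (x * y) = S y * S x) (s t : B ⊗[ℂ] A) (c : ℂ)
    (ht : LinearMap.mul' ℂ B (TensorProduct.map LinearMap.id S t) = algebraMap ℂ B c) :
    LinearMap.mul' ℂ B (TensorProduct.map LinearMap.id S (s * t)) =
      LinearMap.mul' ℂ B (TensorProduct.map LinearMap.id S s) * algebraMap ℂ B c := by
  induction s with
  | zero => simp
  | add x y hx hy => rw [add_mul, map_add, map_add, hx, hy, map_add, map_add, add_mul]
  | tmul y z =>
    have : ∀ t : B ⊗[ℂ] A, LinearMap.mul' ℂ B (TensorProduct.map LinearMap.id S (y ⊗ₜ z * t)) =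
        y * LinearMap.mul' ℂ B (TensorProduct.map LinearMap.id S t) * S z := fun s => by
      induction s with
      | zero => simp
      | add u v hu hv =>
        rw [mul_add, map_add, map_add, hu, hv, map_add, map_add, mul_add, add_mul]
      | tmul u v => simp [hS, mul_assoc]
    rw [this, ht, mul_assoc, Algebra.commutes]
    simp [mul_assoc]

/-- The Hopf `ℂ/2ℤ`-coalgebra `U = {U_a}`. -/
noncomputable def hopf (hℓ : 3 ≤ ℓ) : HopfGCoalgebra ℂ (U ℓ) where
  comul := comul ℓ
  counit := counit hℓ
  antipode := antipode ℓ
  antipode_bijective := antipode_bijective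
  coassoc a b c x := by
    have : (Algebra.TensorProduct.assoc ℂ ℂ ℂ (U ℓ a) (U ℓ b) (U ℓ c)).toAlgHom.comp
          ((Algebra.TensorProduct.map (comul ℓ a b) (AlgHom.id ℂ (U ℓ c))).comp
            (comul ℓ (a + b) c)) =
        (Algebra.TensorProduct.map (AlgHom.id ℂ (U ℓ a)) (comul ℓ b c)).comp
          ((comul ℓ a (b + c)).comp (gcast ℂ (U ℓ) (add_assoc a b c)).toAlgHom) := by
      apply hom_ext
      · simp [Algebra.TensorProduct.one_def, TensorProduct.tmul_add, TensorProduct.add_tmul,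
          add_assoc]
      · simp [Algebra.TensorProduct.one_def, TensorProduct.tmul_add, TensorProduct.add_tmul,
          add_assoc]
      · simp
    exact DFunLike.congr_fun this x
  id_counit a x := by
    have : (Algebra.TensorProduct.rid ℂ ℂ (U ℓ a)).toAlgHom.comp
          ((Algebra.TensorProduct.map (AlgHom.id ℂ (U ℓ a)) (counit hℓ)).comp (comul ℓ a 0)) =
        (gcast ℂ (U ℓ) (add_zero a)).toAlgHom := by
      apply hom_ext <;> simp
    exact DFunLike.congr_fun this x
  counit_id a x := by
    have : (Algebra.TensorProduct.lid ℂ (U ℓ a)).toAlgHom.comp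
          ((Algebra.TensorProduct.map (counit hℓ) (AlgHom.id ℂ (U ℓ a))).comp (comul ℓ 0 a)) =
        (gcast ℂ (U ℓ) (zero_add a)).toAlgHom := by
      apply hom_ext <;> simp
    exact DFunLike.congr_fun this x
  antipode_id a x := by
    have hs := sat ℓ a
    induction x using U.induction with
    | algebraMap c => simp [Algebra.TensorProduct.algebraMap_apply]
    | E => simp [mul_assoc, hs.k_neg']
    | F => simp
    | K α => simp [hs.k_neg']
    | add x y hx hy => simp only [map_add, hx, hy]
    | mul x y hx hy =>
      rw [map_mul, map_mul, mul_map_left _ (by simp) _ _ _ hx, hy, map_mul, map_mul]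
  id_antipode a x := by
    have hs := sat ℓ a
    induction x using U.induction with
    | algebraMap c => simp [Algebra.TensorProduct.algebraMap_apply]
    | E => simp
    | F => simp [← mul_assoc, hs.k_neg']
    | K α => simp [hs.k_neg]
    | add x y hx hy => simp only [map_add, hx, hy]
    | mul x y hx hy =>
      rw [map_mul, map_mul, mul_map_right _ (by simp) _ _ _ hy, hx, map_mul, map_mul]

/-- The pivot `g_a = K^{1-ℓ'} ∈ U_a`. -/
noncomputable def pivot (ℓ : ℕ) (a : G) : (U ℓ a)ˣ where
  val := K ℓ a (1 - (ell' ℓ : ℂ))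
  inv := K ℓ a (-(1 - (ell' ℓ : ℂ)))
  val_inv := (sat ℓ a).k_neg _
  inv_val := (sat ℓ a).k_neg' _

/-- `Ř_{a,b} = ∑_{n=0}^{ℓ'-1} {1}^{2n}/{n}! ξ^{n(n-1)/2} E^n ⊗ F^n`. -/
noncomputable def truncatedR (ℓ : ℕ) (a b : G) : U ℓ a ⊗[ℂ] U ℓ b :=
  ∑ n ∈ Finset.range (ell' ℓ),
    (qn ℓ 1 ^ (2 * n) / qnFactorial ℓ n * xi ℓ ((n : ℂ) * ((n : ℂ) - 1) / 2)) •
      ((E ℓ a ^ n) ⊗ₜ[ℂ] (F ℓ b ^ n))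

/-- `(1/ℓ') ∑_{m₁,m₂=0}^{ℓ'-1} ξ^{-2(m₁+β)(m₂+α)} K^{β+m₁} ⊗ K^{α+m₂} ∈ U_a ⊗ U_b`. -/
noncomputable def cartanSum (ℓ : ℕ) (a b : G) (α β : ℂ) : U ℓ a ⊗[ℂ] U ℓ b :=
  (1 / (ell' ℓ : ℂ)) • ∑ m₁ ∈ Finset.range (ell' ℓ), ∑ m₂ ∈ Finset.range (ell' ℓ),
    xi ℓ (-2 * ((m₁ : ℂ) + β) * ((m₂ : ℂ) + α)) •
      (K ℓ a (β + m₁) ⊗ₜ[ℂ] K ℓ b (α + m₂))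

/-- `H_{a,b} ∈ U_a ⊗ U_b`: the sum above for a chosen pair of lifts `α`, `β` of `a/2`, `b/2`. -/
noncomputable def cartan (ℓ : ℕ) (a b : G) : U ℓ a ⊗[ℂ] U ℓ b :=
  cartanSum ℓ a b (Quotient.out a / 2) (Quotient.out b / 2)

/-- `R_{a,b} = H_{a,b} Ř_{a,b}`. -/
noncomputable def rMatrix (ℓ : ℕ) (a b : G) : U ℓ a ⊗[ℂ] U ℓ b :=
  cartan ℓ a b * truncatedR ℓ a b

/-- `α ∈ ℂ` is congruent to `a/2` modulo `ℤ`, i.e. `2α` represents `a ∈ ℂ/2ℤ`. -/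
def IsHalf (α : ℂ) (a : G) : Prop := ((2 * α : ℂ) : G) = a

theorem isHalf_out (a : G) : IsHalf (Quotient.out a / 2) a := by
  have h : (2 * (Quotient.out a / 2) : ℂ) = Quotient.out a := by ring
  rw [IsHalf, h]
  exact Quotient.out_eq a

end U
end QuantumSl2

/-! The Cartan part is a finite Fourier kernel. In U_a the element K^{ℓ'} is the scalar ξ^{2ℓ'α}
whenever α lifts a/2, so each summand of `cartan` is ℓ'-periodic in either index and the windows of
summation may be translated by integers. This gives independence of the lifts (`pairing_congr`).
Orthogonality of characters makes the kernel multiplicative (`pairing_mul`), hence invertible and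
compatible with Δ. Conjugation by it turns an element of weight d in one leg into that element times
K^d in the other (`pairing_mul_of_weight`).

The part Ř is the truncated q-exponential of {1} E ⊗ F for q = ξ^{-2}. It is 1 plus a nilpotent,
hence invertible; the addition formula `qexp_add` gives the two coproduct axioms; and the
commutators [E, F^n] and [E^n, F] telescope to show that Ř intertwines Δ with a twisted coproduct
(`truncated_mul_e`, `truncated_mul_f`), which conjugation by the Cartan part turns into the opposite
coproduct.

S² is conjugation by K, hence also by g = K^{1-ℓ'}, since K^{-ℓ'} is a scalar.

For the ribbon axiom, all powers of K are moved to the right. Both sides then share the factor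
`pairing` of K with itself, and what remains is `twist_sum`: with q = ξ² and c_n = `rCoeff`, ∑ c_n
q^n F^n E^n K^n g = ∑ c_n q^n E^n F^n K^{-n} g^{-1}. The Casimir element C writes E^n F^n K^{-n} and
F^n E^n K^{-n} as products in the commutative algebra generated by C K^{-1} and K^{-2}. The identity
becomes one of q-series, `sum_eq_sum_of_recurrences`, which follows from a connection formula and
the q-Chu–Vandermonde sum at a root of unity. -/

namespace QCommute

/-! ### Gaussian binomials and q-factorials at a root of unity. -/

theorem qint_succ (q : ℂ) (n : ℕ) : qint q (n + 1) = qint q n + q ^ n := by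
  simp [qint, Finset.sum_range_succ]

theorem qint_succ' (q : ℂ) (n : ℕ) : qint q (n + 1) = q * qint q n + 1 := by
  simp [qint, Finset.sum_range_succ', Finset.mul_sum, pow_succ']

theorem one_sub_mul_qint (q : ℂ) (n : ℕ) : (1 - q) * qint q n = 1 - q ^ n :=
  mul_neg_geom_sum q n

theorem qfact_zero (q : ℂ) : qfact q 0 = 1 := by simp [qfact]

theorem qfact_succ (q : ℂ) (n : ℕ) : qfact q (n + 1) = qfact q n * qint q (n + 1) := by
  simp [qfact, Finset.prod_range_succ]

theorem qint_ne_zero {q : ℂ} {N : ℕ} (hq : IsPrimitiveRoot q N) {n : ℕ} (h0 : 0 < n) (hn : n < N) :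
    qint q n ≠ 0 := by
  intro h
  have h1 := one_sub_mul_qint q n
  rw [h, mul_zero] at h1
  exact hq.pow_ne_one_of_pos_of_lt h0.ne' hn (sub_eq_zero.1 h1.symm).symm

theorem qfact_ne_zero {q : ℂ} {N : ℕ} (hq : IsPrimitiveRoot q N) {n : ℕ} (hn : n < N) :
    qfact q n ≠ 0 :=
  Finset.prod_ne_zero_iff.2 fun i hi =>
    qint_ne_zero hq (Nat.succ_pos i) (by have := Finset.mem_range.1 hi; omega)

theorem qbinom_self (q : ℂ) (n : ℕ) : qbinom q n n = 1 := by
  induction n with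
  | zero => rfl
  | succ n ih => simp [qbinom, ih, qbinom_eq_zero q n (n + 1) (by omega)]

theorem qbinom_zero_right (q : ℂ) (n : ℕ) : qbinom q n 0 = 1 := by cases n <;> rfl

/-- The second Pascal rule for Gaussian binomial coefficients. -/
theorem qbinom_succ_succ' (q : ℂ) (k j : ℕ) :
    qbinom q (k + j + 1) (k + 1) = qbinom q (k + j) (k + 1) + q ^ j * qbinom q (k + j) k := by
  induction hn : k + j generalizing k j with
  | zero =>
    obtain ⟨rfl, rfl⟩ : k = 0 ∧ j = 0 := by omega
    simp [qbinom]
  | succ n ih =>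
    cases k with
    | zero =>
      obtain rfl : j = n + 1 := by omega
      have := ih 0 n (by omega)
      have e : ∀ n, qbinom q (n + 1) (0 + 1) = qbinom q n 0 + q ^ (0 + 1) * qbinom q n (0 + 1) :=
        fun _ => rfl
      simp only [qbinom_zero_right] at this e ⊢
      linear_combination e (n + 1) - e n + q * this
    | succ k =>
      have e1 := ih k j (by omega)
      cases j with
      | zero =>
        obtain rfl : k = n := by omega
        simp [qbinom_self, qbinom_eq_zero]
      | succ j =>
        have e2 := ih (k + 1) j (by omega)
        have d : ∀ n k, qbinom q (n + 1) (k + 1) =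
          qbinom q n k + q ^ (k + 1) * qbinom q n (k + 1) := fun _ _ => rfl
        linear_combination d (n + 1) (k + 1) + e1 + q ^ (k + 2) * e2 - d n (k + 1) -
          q ^ (j + 1) * d n k

/-- `(1 - q^(j+1)) [k+j+1, k] = (1 - q^(k+j+1)) [k+j, k]`. -/
theorem one_sub_mul_qbinom_succ (q : ℂ) (k j : ℕ) :
    (1 - q ^ (j + 1)) * qbinom q (k + j + 1) k = (1 - q ^ (k + j + 1)) * qbinom q (k + j) k := by
  induction k with
  | zero => simp [qbinom]
  | succ k ih =>
    have e1 := qbinom_succ_succ' q k (j + 1)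
    have e2 : qbinom q (k + (j + 1) + 1) (k + 1) =
      qbinom q (k + (j + 1)) k + q ^ (k + 1) * qbinom q (k + (j + 1)) (k + 1) := rfl
    have h1 : k + (j + 1) = k + j + 1 := by omega
    have h2 : k + 1 + j = k + j + 1 := by omega
    rw [h1] at e1 e2
    rw [h2]
    linear_combination e1 - q ^ (j + 1) * e2

/-- [N]! vanishes while [k]! and [N-k]! do not. -/
theorem qbinom_eq_zero_of_isPrimitiveRoot {q : ℂ} {N : ℕ} (hq : IsPrimitiveRoot q N) {k : ℕ}
    (h0 : 0 < k) (hk : k < N) : qbinom q N k = 0 := by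
  have hz : qfact q N = 0 := by
    refine Finset.prod_eq_zero (i := N - 1) (Finset.mem_range.2 (by omega)) ?_
    rw [show N - 1 + 1 = N by omega]
    exact hq.geom_sum_eq_zero (by omega)
  have := qbinom_mul q k (N - k)
  rw [show k + (N - k) = N by omega, hz] at this
  exact (mul_eq_zero.1 this).resolve_right
    (mul_ne_zero (qfact_ne_zero hq hk) (qfact_ne_zero hq (by omega)))

/-! ### The q-series identity. -/

section Series

variable {R : Type*} [CommRing R] [Algebra ℂ R]

/-- The `q`-Pochhammer symbol `(x; q)_n`. -/
noncomputable def poch (q : ℂ) (x : R) (n : ℕ) : R :=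
  ∏ i ∈ Finset.range n, (1 - q ^ i • x)

theorem poch_succ (q : ℂ) (x : R) (n : ℕ) :
    poch q x (n + 1) = poch q x n * (1 - q ^ n • x) := Finset.prod_range_succ _ _

/-- The `q`-Chu–Vandermonde sum at a root of unity. -/
theorem sum_qbinom_smul_poch {q : ℂ} {N : ℕ} (hq : IsPrimitiveRoot q N) (x : R) (r m : ℕ)
    (h : m + r + 1 = N) :
    ∑ j ∈ Finset.range (r + 1), (q ^ j * qbinom q (m + j) m) • poch q x j = x ^ r := by
  induction r generalizing m with
  | zero => simp [poch, qbinom_self]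
  | succ r ih =>
    have e := ih (m + 1) (by omega)
    -- Summation by parts: q^j x (x;q)_j = (x;q)_j - (x;q)_{j+1}, and the second Pascal rule
    -- collapses the differences of coefficients.
    have key : ∀ s, x * ∑ j ∈ Finset.range s, (q ^ j * qbinom q (m + 1 + j) (m + 1)) • poch q x j =
        ∑ j ∈ Finset.range s, (q ^ j * qbinom q (m + j) m) • poch q x j
          - qbinom q (m + s) (m + 1) • poch q x s := by
      intro s
      induction s with
      | zero => simp [qbinom_eq_zero]
      | succ s ihs =>
        rw [Finset.sum_range_succ, mul_add, ihs, Finset.sum_range_succ, poch_succ]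
        have e1 := qbinom_succ_succ' q m s
        rw [show m + 1 + s = m + s + 1 by omega, show m + (s + 1) = m + s + 1 by omega, e1]
        simp only [Algebra.smul_def, map_add, map_mul, map_pow]
        ring
    rw [pow_succ', ← e, key, Finset.sum_range_succ _ (r + 1)]
    -- The boundary term is the missing summand j = r+1, because [N-1, m+1] + q^{r+1} [N-1, m] = [N,
    -- m+1] = 0.
    have e1 := qbinom_succ_succ' q m (r + 1)
    rw [show m + (r + 1) + 1 = N by omega,
      qbinom_eq_zero_of_isPrimitiveRoot hq (by omega) (by omega)] at e1
    rw [sub_eq_add_neg, ← neg_smul]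
    congr 2
    linear_combination -e1

/-- With σ = a + b and qκ = ab, l_n is (a;q)_n (b;q)_n / (q;q)_n, and the factors of m_n have
numerators (a - q^{n+1})(b - q^{n+1})/q. This is the connection formula between the two families;
recurrences in σ and κ avoid adjoining a and b. -/
theorem eq_sum_qbinom_smul_of_recurrences {q : ℂ} {N : ℕ} (hq : IsPrimitiveRoot q N) (σ κ : R) (l m : ℕ → R)
    (hl0 : l 0 = 1) (hm0 : m 0 = 1)
    (hl : ∀ n, n + 1 < N →
      (1 - q ^ (n + 1)) • l (n + 1) = l n * (1 - q ^ n • σ + q ^ (2 * n + 1) • κ))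
    (hm : ∀ n, n + 1 < N →
      (1 - q ^ (n + 1)) • m (n + 1) = m n * (κ - q ^ n • σ + algebraMap ℂ R (q ^ (2 * n + 1))))
    (n : ℕ) (hn : n < N) :
    l n = ∑ i ∈ Finset.range (n + 1), qbinom q n i • (poch q κ (n - i) * m i) := by
  induction n with
  | zero => simp [hl0, hm0, poch, qbinom]
  | succ n ih =>
    have hne : (1 - q ^ (n + 1)) ≠ 0 :=
      sub_ne_zero.2 (hq.pow_ne_one_of_pos_of_lt (by omega) hn).symm
    have hinj : ∀ x y : R, (1 - q ^ (n + 1)) • x = (1 - q ^ (n + 1)) • y → x = y := fun x y h => by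
      simpa [smul_smul, inv_mul_cancel₀ hne] using congrArg ((1 - q ^ (n + 1))⁻¹ • ·) h
    apply hinj
    rw [hl n hn, ih (by omega), Finset.sum_mul, Finset.smul_sum]
    -- For n = i + j the factor of l splits as q^j (κ - q^i σ + q^{2i+1}) + (1 - q^{n+i+1})(1 - q^j
    -- κ): the first part raises the index of m, the second that of the Pochhammer symbol.
    have step : ∀ i ∈ Finset.range (n + 1),
        qbinom q n i • (poch q κ (n - i) * m i) * (1 - q ^ n • σ + q ^ (2 * n + 1) • κ) =
        (q ^ (n - i) * (1 - q ^ (i + 1)) * qbinom q n i) • (poch q κ (n - i) * m (i + 1)) +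
        ((1 - q ^ (n + i + 1)) * qbinom q n i) • (poch q κ (n + 1 - i) * m i) := by
      intro i hi
      obtain ⟨j, rfl⟩ := Nat.exists_eq_add_of_le (Nat.lt_succ_iff.1 (Finset.mem_range.1 hi))
      have h1 := hm i (by omega)
      rw [show i + j + 1 - i = j + 1 by omega, show i + j - i = j by omega, poch_succ,
        show (q ^ j * (1 - q ^ (i + 1)) * qbinom q (i + j) i) • (poch q κ j * m (i + 1)) =
          (q ^ j * qbinom q (i + j) i) • (poch q κ j * ((1 - q ^ (i + 1)) • m (i + 1))) by
          rw [mul_smul_comm, smul_smul]; congr 1; ring, h1]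
      simp only [Algebra.smul_def, map_mul, map_pow, map_sub, map_one]
      ring
    rw [Finset.sum_congr rfl step, Finset.sum_add_distrib,
      Finset.sum_range_succ (fun i => (q ^ (n - i) * (1 - q ^ (i + 1)) * qbinom q n i) • _) n,
      Finset.sum_range_succ' (fun i => ((1 - q ^ (n + i + 1)) * qbinom q n i) • _) n,
      Finset.sum_range_succ _ (n + 1), Finset.sum_range_succ' _ n]
    have step2 : ∀ i ∈ Finset.range n,
        (1 - q ^ (n + 1)) • qbinom q (n + 1) (i + 1) • (poch q κ (n + 1 - (i + 1)) * m (i + 1)) =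
        (q ^ (n - i) * (1 - q ^ (i + 1)) * qbinom q n i) • (poch q κ (n - i) * m (i + 1)) +
        ((1 - q ^ (n + (i + 1) + 1)) * qbinom q n (i + 1)) •
          (poch q κ (n + 1 - (i + 1)) * m (i + 1)) := by
      intro i hi
      obtain ⟨j, hj⟩ := Nat.exists_eq_add_of_le (Nat.succ_le_of_lt (Finset.mem_range.1 hi))
      rw [smul_smul, Nat.add_sub_add_right, ← add_smul]
      congr 1
      have e1 := qbinom_succ_succ' q i (j + 1)
      have e2 := one_sub_mul_qbinom_succ q (i + 1) j
      rw [show i + (j + 1) = n by omega] at e1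
      rw [show i + 1 + j = n by omega] at e2
      rw [show n - i = j + 1 by omega]
      have h3 : q ^ (n + 1) = q ^ (i + 1) * q ^ (j + 1) := by rw [← pow_add]; congr 1; omega
      rw [show n + (i + 1) + 1 = (n + 1) + (i + 1) by omega, pow_add q (n + 1)]
      rw [h3] at e2 ⊢
      linear_combination (1 - q ^ (i + 1)) * e1 + q ^ (i + 1) * e2
    rw [Finset.sum_congr rfl step2, Finset.sum_add_distrib]
    simp only [qbinom_self, Nat.sub_self, pow_zero, one_mul, mul_one, add_zero, Nat.sub_zero,
      smul_smul]
    simp only [qbinom_zero_right, mul_one]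
    abel

/-- Two families of products related by a change of nodes have the same `q`-weighted sums. -/
theorem sum_eq_sum_of_recurrences {q : ℂ} {N : ℕ} (hq : IsPrimitiveRoot q N) (σ κ : R)
    (l m : ℕ → R) (hl0 : l 0 = 1) (hm0 : m 0 = 1)
    (hl : ∀ n, n + 1 < N →
      (1 - q ^ (n + 1)) • l (n + 1) = l n * (1 - q ^ n • σ + q ^ (2 * n + 1) • κ))
    (hm : ∀ n, n + 1 < N →
      (1 - q ^ (n + 1)) • m (n + 1) = m n * (κ - q ^ n • σ + algebraMap ℂ R (q ^ (2 * n + 1)))) :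
    ∑ n ∈ Finset.range N, q ^ n • l n = ∑ n ∈ Finset.range N, q ^ n • (m n * κ ^ (N - 1 - n)) := by
  have h1 : ∀ n ∈ Finset.range N, q ^ n • l n = ∑ i ∈ Finset.range (n + 1),
      (fun i j => (q ^ (i + j) * qbinom q (i + j) i) • (poch q κ j * m i)) i (n - i) := by
    intro n hn
    rw [eq_sum_qbinom_smul_of_recurrences hq σ κ l m hl0 hm0 hl hm n (Finset.mem_range.1 hn), Finset.smul_sum]
    refine Finset.sum_congr rfl fun i hi => ?_
    have : i + (n - i) = n := by have := Finset.mem_range.1 hi; omega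
    simp only [this, smul_smul]
  -- After exchanging the sums, the inner one over j < N - i is q-Chu–Vandermonde, with value
  -- κ^{N-1-i}.
  rw [Finset.sum_congr rfl h1, Finset.sum_range_diag_flip N
    (fun i j => (q ^ (i + j) * qbinom q (i + j) i) • (poch q κ j * m i))]
  refine Finset.sum_congr rfl fun i hi => ?_
  have hi := Finset.mem_range.1 hi
  rw [← sum_qbinom_smul_poch hq κ (N - 1 - i) i (by omega), Finset.mul_sum, Finset.smul_sum,
    show N - 1 - i + 1 = N - i by omega]
  refine Finset.sum_congr rfl fun j _ => ?_
  rw [mul_smul_comm, smul_smul, mul_comm (m i), pow_add, mul_assoc]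

end Series

end QCommute

/-! ### The truncated q-exponential. -/

namespace QCommute

section QExp

variable {A : Type*} [Ring A] [Algebra ℂ A]

/-- The truncated `q`-exponential `∑_{n<N} z^n / [n]_q!`. -/
noncomputable def qexp (q : ℂ) (N : ℕ) (z : A) : A :=
  ∑ n ∈ Finset.range N, (qfact q n)⁻¹ • z ^ n

theorem map_qexp {B : Type*} [Ring B] [Algebra ℂ B] (φ : A →ₐ[ℂ] B) (q : ℂ) (N : ℕ) (z : A) :
    φ (qexp q N z) = qexp q N (φ z) := by
  simp [qexp]

theorem _root_.SemiconjBy.qexp {a x y : A} (h : SemiconjBy a x y) (q : ℂ) (N : ℕ) :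
    SemiconjBy a (qexp q N x) (qexp q N y) := by
  simp only [SemiconjBy, QCommute.qexp, Finset.mul_sum, Finset.sum_mul]
  refine Finset.sum_congr rfl fun n _ => ?_
  rw [mul_smul_comm, smul_mul_assoc, (h.pow_right n).eq]

/-- The constant term is 1 and the rest is the nilpotent z times an element commuting with z. -/
theorem isUnit_qexp (q : ℂ) {N : ℕ} (hN : N ≠ 0) {z : A} (hz : z ^ N = 0) :
    IsUnit (qexp q N z) := by
  obtain ⟨M, rfl⟩ := Nat.exists_eq_succ_of_ne_zero hN
  rw [qexp, Finset.sum_range_succ', qfact_zero, inv_one, one_smul, pow_zero, add_comm]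
  have : ∑ k ∈ Finset.range M, (qfact q (k + 1))⁻¹ • z ^ (k + 1) =
      z * ∑ k ∈ Finset.range M, (qfact q (k + 1))⁻¹ • z ^ k := by
    rw [Finset.mul_sum]
    exact Finset.sum_congr rfl fun k _ => by rw [mul_smul_comm, ← pow_succ']
  rw [this]
  refine IsNilpotent.isUnit_one_add (Commute.isNilpotent_mul_right ?_ ⟨_, hz⟩)
  exact Commute.sum_right _ _ _ fun k _ => ((Commute.refl z).pow_right k).smul_right _

/-- The addition formula for the truncated `q`-exponential. -/
theorem qexp_add {q : ℂ} {N : ℕ} (hq : IsPrimitiveRoot q N) {x y : A} (h : y * x = q • (x * y))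
    (h0 : ∀ i j, N ≤ i + j → x ^ i * y ^ j = 0) :
    qexp q N (x + y) = qexp q N x * qexp q N y := by
  have h1 : ∀ n ∈ Finset.range N, (qfact q n)⁻¹ • (x + y) ^ n = ∑ k ∈ Finset.range (n + 1),
      ((qfact q k)⁻¹ * (qfact q (n - k))⁻¹) • (x ^ k * y ^ (n - k)) := by
    intro n hn
    rw [add_pow_eq h, Finset.smul_sum]
    refine Finset.sum_congr rfl fun k hk => ?_
    have hn := Finset.mem_range.1 hn
    have hk := Finset.mem_range.1 hk
    have e := qbinom_mul q k (n - k)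
    rw [show k + (n - k) = n by omega] at e
    have hne1 := qfact_ne_zero hq (show k < N by omega)
    have hne2 := qfact_ne_zero hq (show n - k < N by omega)
    have hne3 := qfact_ne_zero hq hn
    rw [smul_smul]
    congr 1
    field_simp
    linear_combination e
  rw [qexp, Finset.sum_congr rfl h1, Finset.sum_range_diag_flip N
    (fun i j => ((qfact q i)⁻¹ * (qfact q j)⁻¹) • (x ^ i * y ^ j)), qexp, qexp, Finset.sum_mul]
  refine Finset.sum_congr rfl fun i _ => ?_
  rw [Finset.mul_sum]
  -- The binomial theorem only produces the terms with i + j < N; `h0` makes the other terms of the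
  -- product vanish.
  have hsub : Finset.range (N - i) ⊆ Finset.range N := Finset.range_mono (Nat.sub_le _ _)
  rw [← Finset.sum_subset hsub fun j _ hj => ?_]
  · exact Finset.sum_congr rfl fun j _ => by rw [smul_mul_smul_comm]
  · rw [smul_mul_smul_comm, h0 i j (by have := mt Finset.mem_range.2 hj; omega), smul_zero]

end QExp

end QCommute

/-! ### Powers of ξ and orthogonality of characters. -/

namespace QuantumSl2

theorem xi_natCast_mul (ℓ n : ℕ) (x : ℂ) : xi ℓ (n * x) = xi ℓ x ^ n := by
  rw [xi, xi, ← Complex.exp_nat_mul]; ring_nf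

theorem ell'_ne_zero {ℓ : ℕ} (hℓ : ℓ ≠ 0) : ell' ℓ ≠ 0 :=
  (Nat.div_pos (Nat.le_of_dvd (by omega) (Nat.gcd_dvd_left _ _))
    (Nat.gcd_pos_of_pos_right _ (by norm_num))).ne'

theorem one_lt_ell' {ℓ : ℕ} (hℓ : 3 ≤ ℓ) : 1 < ell' ℓ := by
  have h1 : Nat.gcd ℓ 2 ∣ 2 := Nat.gcd_dvd_right _ _
  have h2 := Nat.div_mul_cancel (Nat.gcd_dvd_left ℓ 2)
  have h3 := Nat.le_of_dvd (by norm_num) h1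
  rw [ell']
  by_contra h
  interval_cases h4 : ℓ / Nat.gcd ℓ 2 <;> omega

theorem isPrimitiveRoot_xi_neg_two {ℓ : ℕ} (hℓ : ℓ ≠ 0) : IsPrimitiveRoot (xi ℓ (-2)) (ell' ℓ) := by
  have : xi ℓ (-2) = (xi ℓ 2)⁻¹ := eq_inv_of_mul_eq_one_right (xi_mul_neg ℓ 2)
  rw [this]
  exact (isPrimitiveRoot_xi_two hℓ).inv

theorem xi_ne_zero (ℓ : ℕ) (x : ℂ) : xi ℓ x ≠ 0 := Complex.exp_ne_zero _

/-- {1} = 0 would force ξ² = 1, whereas ξ² has order ℓ' > 1. -/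
theorem qn_one_ne_zero {ℓ : ℕ} (hℓ : 3 ≤ ℓ) : qn ℓ 1 ≠ 0 := by
  intro h
  have h1 := isPrimitiveRoot_xi_two (ℓ := ℓ) (by omega)
  refine h1.ne_one (one_lt_ell' hℓ) ?_
  rw [show (2 : ℂ) = 1 + 1 by norm_num, xi_add]
  nth_rw 1 [sub_eq_zero.1 h]
  rw [mul_comm, xi_mul_neg]

/-- `ξ^{2ℓ'k} = 1` for `k ∈ ℤ`. -/
theorem xi_two_ell'_mul {ℓ : ℕ} (hℓ : ℓ ≠ 0) (k : ℤ) : xi ℓ (2 * ell' ℓ * k) = 1 := by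
  have h1 := (isPrimitiveRoot_xi_two hℓ).pow_eq_one
  rw [← xi_natCast_mul] at h1
  have h2 : ∀ n : ℕ, xi ℓ (2 * ell' ℓ * n) = 1 := fun n => by
    rw [show (2 * ell' ℓ * n : ℂ) = n * (ell' ℓ * 2) by ring, xi_natCast_mul, h1, one_pow]
  obtain ⟨n, rfl | rfl⟩ := k.eq_nat_or_neg
  · exact_mod_cast h2 n
  · have := xi_mul_neg ℓ (2 * ell' ℓ * n)
    rw [h2, one_mul] at this
    rw [← this]; push_cast; ring_nf

/-- Orthogonality of characters of `ℤ/ℓ'`. -/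
theorem sum_xi {ℓ : ℕ} (hℓ : ℓ ≠ 0) (β α : ℂ) {j j' : ℕ} (hj : j < ell' ℓ) (hj' : j' < ell' ℓ) :
    ∑ i ∈ Finset.range (ell' ℓ), xi ℓ (-2 * (β + i) * ((α + j) - (α + j'))) =
      if j = j' then (ell' ℓ : ℂ) else 0 := by
  split_ifs with h
  · simp [h, xi_zero]
  · have h1 : ∀ i ∈ Finset.range (ell' ℓ), xi ℓ (-2 * (β + i) * ((α + j) - (α + j'))) =
        xi ℓ (-2 * β * (j - j')) * xi ℓ (-2 * (j - j')) ^ i := fun i _ => by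
      rw [← xi_natCast_mul, ← xi_add]; congr 1; ring
    rw [Finset.sum_congr rfl h1, ← Finset.mul_sum]
    have hq := isPrimitiveRoot_xi_neg_two hℓ
    have h2 : xi ℓ (-2 * (j - j')) ≠ 1 := by
      intro h3
      have e : xi ℓ (-2) ^ j = xi ℓ (-2) ^ j' := by
        rw [← xi_natCast_mul, ← xi_natCast_mul,
          show (j * -2 : ℂ) = -2 * (j - j') + j' * -2 by ring, xi_add, h3, one_mul]
      exact h (hq.pow_inj hj hj' e)
    have h4 : xi ℓ (-2 * (j - j')) ^ ell' ℓ = 1 := by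
      rw [← xi_natCast_mul, ← xi_two_ell'_mul hℓ ((j' : ℤ) - j)]
      congr 1; push_cast; ring
    have h5 := mul_geom_sum (xi ℓ (-2 * (j - j'))) (ell' ℓ)
    rw [h4, sub_self] at h5
    rw [(mul_eq_zero.1 h5).resolve_left (sub_ne_zero.2 h2), mul_zero]

/-! ### The Cartan part as a Fourier pairing of two toral families. -/

section Periodic

variable {M : Type*} [AddCommGroup M]

/-- A sum of an N-periodic function over N consecutive points does not see integer translations of
the window. Every reindexing of the Cartan part rests on this. -/
theorem sum_range_shift (N : ℕ) (f : ℂ → M) (hf : ∀ x, f (x + N) = f x) (x : ℂ) (k : ℤ) :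
    ∑ i ∈ Finset.range N, f (x + k + i) = ∑ i ∈ Finset.range N, f (x + i) := by
  have h1 : ∀ x, ∑ i ∈ Finset.range N, f (x + 1 + i) = ∑ i ∈ Finset.range N, f (x + i) := by
    intro x
    have e1 := Finset.sum_range_succ (fun i : ℕ => f (x + i)) N
    have e2 := Finset.sum_range_succ' (fun i : ℕ => f (x + i)) N
    rw [e1, hf] at e2
    simp only [Nat.cast_zero, add_zero] at e2
    rw [add_right_cancel e2]
    exact Finset.sum_congr rfl fun i _ => by congr 1; push_cast; ring
  induction k with
  | zero => simp
  | succ n ih =>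
    rw [← ih, ← h1 (x + (n : ℤ))]
    exact Finset.sum_congr rfl fun i _ => by congr 1; push_cast; ring
  | pred n ih =>
    rw [← ih, ← h1 (x + ((-(n : ℤ) - 1 : ℤ) : ℂ))]
    exact Finset.sum_congr rfl fun i _ => by congr 1; push_cast; ring

end Periodic

/-- A family `u t`, `t ∈ ℂ`, behaving like `t ↦ K^t` in `U_a`, where `2α` represents `a`. -/
structure IsToral (ℓ : ℕ) {B : Type*} [Ring B] [Algebra ℂ B] (u : ℂ → B) (α : ℂ) : Prop where
  mul (x y : ℂ) : u x * u y = u (x + y)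
  zero : u 0 = 1
  period : u (ell' ℓ) = xi ℓ (2 * ell' ℓ * α) • 1

/-- `(1/ℓ') ∑ ξ^{-2ts} u(t) v(s)` over `t ∈ β + {0,…,ℓ'-1}` and `s ∈ α + {0,…,ℓ'-1}`. -/
noncomputable def pairing (ℓ : ℕ) {B : Type*} [Ring B] [Algebra ℂ B] (u v : ℂ → B) (α β : ℂ) : B :=
  (1 / (ell' ℓ : ℂ)) • ∑ i ∈ Finset.range (ell' ℓ), ∑ j ∈ Finset.range (ell' ℓ),
    xi ℓ (-2 * (β + i) * (α + j)) • (u (β + i) * v (α + j))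

section Pairing

variable {ℓ : ℕ} {B : Type*} [Ring B] [Algebra ℂ B] {u v w : ℂ → B} {α β γ : ℂ}

theorem IsToral.add_period (hu : IsToral ℓ u α) (x : ℂ) :
    u (x + ell' ℓ) = xi ℓ (2 * ell' ℓ * α) • u x := by
  rw [← hu.mul, hu.period, mul_smul_comm, mul_one]

theorem IsToral.neg (hu : IsToral ℓ u α) : IsToral ℓ (fun t => u (-t)) (-α) where
  mul x y := by rw [hu.mul]; congr 1; ring
  zero := by rw [neg_zero, hu.zero]
  period := by
    have h := hu.add_period (-ell' ℓ)
    rw [neg_add_cancel, hu.zero] at h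
    rw [h, smul_smul, ← xi_add]
    simp [xi_zero]

theorem IsToral.map (hu : IsToral ℓ u α) {C : Type*} [Ring C] [Algebra ℂ C] (φ : B →ₐ[ℂ] C) :
    IsToral ℓ (fun t => φ (u t)) α where
  mul x y := by rw [← map_mul, hu.mul]
  zero := by rw [hu.zero, map_one]
  period := by rw [hu.period, map_smul, map_one]

theorem map_pairing {C : Type*} [Ring C] [Algebra ℂ C] (φ : B →ₐ[ℂ] C) (u v : ℂ → B) (α β : ℂ) :
    φ (pairing ℓ u v α β) = pairing ℓ (fun t => φ (u t)) (fun t => φ (v t)) α β := by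
  simp [pairing]

theorem pairing_comm (h : ∀ x y, Commute (u x) (v y)) (α β : ℂ) :
    pairing ℓ u v α β = pairing ℓ v u β α := by
  rw [pairing, pairing, Finset.sum_comm]
  congr 1
  refine Finset.sum_congr rfl fun i _ => Finset.sum_congr rfl fun j _ => ?_
  rw [(h _ _).eq]; congr 2; ring

/-- The period of u contributes ξ^{2ℓ'α} and the kernel ξ^{-2ℓ'(α+j)}; their product ξ^{-2ℓ'j} is 1.
This is why the second index must run over α + ℤ with α attached to u. -/
theorem periodic_left (hℓ : ℓ ≠ 0) (hu : IsToral ℓ u α) (j : ℕ) (y : B) (t : ℂ) :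
    xi ℓ (-2 * (t + ell' ℓ) * (α + j)) • (u (t + ell' ℓ) * y) =
      xi ℓ (-2 * t * (α + j)) • (u t * y) := by
  rw [hu.add_period, smul_mul_assoc, smul_smul, ← xi_add]
  have := xi_two_ell'_mul hℓ (-(j : ℤ))
  rw [← mul_one (xi ℓ (-2 * t * (α + j))), ← this, ← xi_add]
  congr 2; push_cast; ring

theorem pairing_add_int (hℓ : ℓ ≠ 0) (hu : IsToral ℓ u α) (v : ℂ → B) (β : ℂ) (k : ℤ) :
    pairing ℓ u v α (β + k) = pairing ℓ u v α β := by
  rw [pairing, pairing]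
  congr 1
  rw [Finset.sum_comm]
  refine Eq.trans ?_ Finset.sum_comm
  refine Finset.sum_congr rfl fun j _ => ?_
  exact sum_range_shift _ (fun t => xi ℓ (-2 * t * (α + j)) • (u t * v (α + j)))
    (periodic_left hℓ hu j _) β k

theorem pairing_congr (hℓ : ℓ ≠ 0) (hu : IsToral ℓ u α) (hv : IsToral ℓ v β)
    (h : ∀ x y, Commute (u x) (v y)) (k l : ℤ) :
    pairing ℓ u v (α + k) (β + l) = pairing ℓ u v α β := by
  -- The label of a toral family matters only modulo ℤ, since ξ^{2ℓ'k} = 1.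
  have hu' : IsToral ℓ u (α + k) := ⟨hu.mul, hu.zero, by
    rw [hu.period, mul_add, xi_add, xi_two_ell'_mul hℓ, mul_one]⟩
  rw [pairing_add_int hℓ hu', pairing_comm h, pairing_add_int hℓ hv, pairing_comm h]

/-- Multiplicativity of the pairing in its second argument. -/
theorem pairing_mul (hℓ : ℓ ≠ 0) (hu : IsToral ℓ u α) (v w : ℂ → B)
    (huv : ∀ x y, Commute (u x) (v y)) (β γ : ℂ) :
    pairing ℓ u v α β * pairing ℓ u w α γ = pairing ℓ u (fun t => v t * w t) α (β + γ) := by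
  have hN : (ell' ℓ : ℂ) ≠ 0 := by exact_mod_cast ell'_ne_zero hℓ
  set R := Finset.range (ell' ℓ) with hR
  -- For fixed j and j', translating the window of i' makes i + i' a single index k. Then i survives
  -- only in a character, whose sum over i vanishes unless j = j'.
  have h1 : ∀ i ∈ R, ∀ j ∈ R, ∀ j' ∈ R,
      ∑ i' ∈ R, (xi ℓ (-2 * (β + i) * (α + j)) • (u (β + i) * v (α + j))) *
        (xi ℓ (-2 * (γ + i') * (α + j')) • (u (γ + i') * w (α + j'))) =
      xi ℓ (-2 * (β + i) * ((α + j) - (α + j'))) • ∑ k ∈ R,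
        xi ℓ (-2 * (β + γ + k) * (α + j')) • (u (β + γ + k) * (v (α + j) * w (α + j'))) := by
    intro i _ j _ j' _
    rw [← sum_range_shift _ (fun t => xi ℓ (-2 * t * (α + j')) • (u t * (v (α + j) * w (α + j'))))
      (periodic_left hℓ hu j' _) (β + γ) i, Finset.smul_sum]
    refine Finset.sum_congr rfl fun i' _ => ?_
    have e : u (β + i) * v (α + j) * (u (γ + i') * w (α + j')) =
        u (β + γ + (i : ℤ) + i') * (v (α + j) * w (α + j')) := by
      rw [mul_assoc, ← mul_assoc (v _), ← (huv _ _).eq, mul_assoc, ← mul_assoc (u _), hu.mul]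
      congr 2; push_cast; ring
    rw [smul_mul_smul_comm, e, smul_smul, ← xi_add, ← xi_add]
    congr 2; push_cast; ring
  have h2 : (∑ i ∈ R, ∑ j ∈ R, xi ℓ (-2 * (β + i) * (α + j)) • (u (β + i) * v (α + j))) *
      (∑ i ∈ R, ∑ j ∈ R, xi ℓ (-2 * (γ + i) * (α + j)) • (u (γ + i) * w (α + j))) =
      (ell' ℓ : ℂ) • ∑ k ∈ R, ∑ j ∈ R,
        xi ℓ (-2 * (β + γ + k) * (α + j)) • (u (β + γ + k) * (v (α + j) * w (α + j))) := by
    calc _ = ∑ j ∈ R, ∑ j' ∈ R, ∑ i ∈ R, ∑ i' ∈ R,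
          (xi ℓ (-2 * (β + i) * (α + j)) • (u (β + i) * v (α + j))) *
            (xi ℓ (-2 * (γ + i') * (α + j')) • (u (γ + i') * w (α + j'))) := by
          rw [Finset.sum_comm, Finset.sum_mul]
          refine Finset.sum_congr rfl fun j _ => ?_
          rw [Finset.sum_comm (s := R) (t := R), Finset.mul_sum]
          refine Finset.sum_congr rfl fun j' _ => ?_
          rw [Finset.sum_mul_sum]
      _ = ∑ j ∈ R, ∑ j' ∈ R, ∑ i ∈ R, xi ℓ (-2 * (β + i) * ((α + j) - (α + j'))) • ∑ k ∈ R,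
        xi ℓ (-2 * (β + γ + k) * (α + j')) • (u (β + γ + k) * (v (α + j) * w (α + j'))) :=
          Finset.sum_congr rfl fun j hj => Finset.sum_congr rfl fun j' hj' =>
            Finset.sum_congr rfl fun i hi => h1 i hi j hj j' hj'
      _ = ∑ j ∈ R, ∑ j' ∈ R, (if j = j' then (ell' ℓ : ℂ) else 0) • ∑ k ∈ R,
        xi ℓ (-2 * (β + γ + k) * (α + j')) • (u (β + γ + k) * (v (α + j) * w (α + j'))) := by
          refine Finset.sum_congr rfl fun j hj => Finset.sum_congr rfl fun j' hj' => ?_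
          rw [← Finset.sum_smul,
            sum_xi hℓ β α (Finset.mem_range.1 hj) (Finset.mem_range.1 hj')]
      _ = _ := by
          refine Eq.trans ?_ (congrArg _ Finset.sum_comm)
          rw [Finset.smul_sum]
          refine Finset.sum_congr rfl fun j hj => ?_
          simp only [ite_smul, zero_smul, Finset.sum_ite_eq, if_pos hj]
  rw [pairing, pairing, pairing, smul_mul_smul_comm, h2, smul_smul]
  congr 1
  field_simp

theorem pairing_one (hℓ : ℓ ≠ 0) (hu : IsToral ℓ u α) : pairing ℓ u (fun _ => 1) α 0 = 1 := by
  have hN : (ell' ℓ : ℂ) ≠ 0 := by exact_mod_cast ell'_ne_zero hℓ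
  have h0 : 0 < ell' ℓ := Nat.pos_of_ne_zero (ell'_ne_zero hℓ)
  rw [pairing]
  have h1 : ∀ i ∈ Finset.range (ell' ℓ), ∑ j ∈ Finset.range (ell' ℓ),
      xi ℓ (-2 * (0 + i) * (α + j)) • (u (0 + i) * 1) =
      (if i = 0 then (ell' ℓ : ℂ) else 0) • u i := by
    intro i hi
    rw [← sum_xi hℓ α 0 (Finset.mem_range.1 hi) h0, Finset.sum_smul]
    refine Finset.sum_congr rfl fun j _ => ?_
    rw [mul_one, zero_add]
    congr 2; push_cast; ring
  rw [Finset.sum_congr rfl h1]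
  simp [h0, hu.zero, smul_smul, hN]

/-- By multiplicativity the inverse is the pairing of u with the inverse family t ↦ v(-t), based at
-β. -/
theorem isUnit_pairing (hℓ : ℓ ≠ 0) (hu : IsToral ℓ u α) (hv : IsToral ℓ v β)
    (huv : ∀ x y, Commute (u x) (v y)) : IsUnit (pairing ℓ u v α β) := by
  have e1 := pairing_mul hℓ hu v (fun t => v (-t)) huv β (-β)
  have e2 := pairing_mul hℓ hu (fun t => v (-t)) v (fun x y => huv x _) (-β) β
  simp only [hv.mul, add_neg_cancel, neg_add_cancel, hv.zero, pairing_one hℓ hu] at e1 e2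
  exact ⟨⟨_, _, e1, e2⟩, rfl⟩

/-- Commuting the pairing past an element of weight `d` for `u`. -/
theorem pairing_mul_of_weight (hℓ : ℓ ≠ 0) (hv : IsToral ℓ v β)
    (huv : ∀ x y, Commute (u x) (v y)) (d : ℤ) {x : B}
    (hux : ∀ t, u t * x = xi ℓ (2 * t * d) • (x * u t)) (hvx : ∀ s, Commute (v s) x) :
    pairing ℓ u v α β * x = x * v d * pairing ℓ u v α β := by
  have huv' : ∀ x y, Commute (v x) (u y) := fun x y => (huv y x).symm
  rw [pairing, smul_mul_assoc, mul_smul_comm]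
  congr 1
  rw [Finset.sum_mul, Finset.mul_sum]
  refine Finset.sum_congr rfl fun i _ => ?_
  -- Passing x to the left turns ξ^{-2ts} into ξ^{-2t(s-d)}. The window of s is therefore translated
  -- by -d, and v(s) = v(d) v(s-d) releases the factor v(d).
  have e := sum_range_shift (ell' ℓ) (fun s => xi ℓ (-2 * s * (β + i)) • (v s * (u (β + i))))
    (periodic_left hℓ hv i _) α (-d)
  have e' : ∑ j ∈ Finset.range (ell' ℓ), xi ℓ (-2 * (β + i) * (α + j)) • (u (β + i) * v (α + j)) =
      ∑ j ∈ Finset.range (ell' ℓ),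
        xi ℓ (-2 * (α + (-d : ℤ) + j) * (β + i)) • (v (α + (-d : ℤ) + j) * u (β + i)) := by
    rw [e]
    refine Finset.sum_congr rfl fun j _ => ?_
    rw [(huv _ _).eq]; congr 2; ring
  nth_rw 2 [e']
  rw [Finset.sum_mul, Finset.mul_sum]
  refine Finset.sum_congr rfl fun j _ => ?_
  rw [smul_mul_assoc, mul_assoc (u _), (hvx _).eq, ← mul_assoc, hux, smul_mul_assoc, smul_smul, ← xi_add,
    mul_smul_comm, mul_assoc x (v d), ← mul_assoc (v d), hv.mul, (huv' _ _).eq, ← mul_assoc x (u _)]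
  congr 2
  · push_cast; ring
  · push_cast; ring_nf

end Pairing

end QuantumSl2

/-! ### Transfer of the q-series identity to commuting elements of a noncommutative algebra. -/

namespace QCommute

open scoped IsMulCommutative in
/-- `sum_eq_sum_of_recurrences` for commuting elements of a noncommutative algebra. -/
theorem sum_eq_sum_of_recurrences' {A : Type*} [Ring A] [Algebra ℂ A] {q : ℂ} {N : ℕ}
    (hq : IsPrimitiveRoot q N) {σ κ : A} (h : Commute σ κ)
    (l m : ℕ → A) (hl0 : l 0 = 1) (hm0 : m 0 = 1)
    (hl : ∀ n, n + 1 < N →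
      (1 - q ^ (n + 1)) • l (n + 1) = l n * (1 - q ^ n • σ + q ^ (2 * n + 1) • κ))
    (hm : ∀ n, n + 1 < N →
      (1 - q ^ (n + 1)) • m (n + 1) = m n * (κ - q ^ n • σ + algebraMap ℂ A (q ^ (2 * n + 1)))) :
    ∑ n ∈ Finset.range N, q ^ n • l n = ∑ n ∈ Finset.range N, q ^ n • (m n * κ ^ (N - 1 - n)) := by
  have hcomm : ∀ x ∈ ({σ, κ} : Set A), ∀ y ∈ ({σ, κ} : Set A), x * y = y * x := by
    rintro x (rfl | rfl) y (rfl | rfl)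
    exacts [rfl, h.eq, h.eq.symm, rfl]
  have := Algebra.isMulCommutative_adjoin ℂ hcomm
  let S := Algebra.adjoin ℂ ({σ, κ} : Set A)
  let s : S := ⟨σ, Algebra.subset_adjoin (by simp)⟩
  let c : S := ⟨κ, Algebra.subset_adjoin (by simp)⟩
  have hne : ∀ n, n + 1 < N → (1 - q ^ (n + 1)) ≠ 0 := fun n hn =>
    sub_ne_zero.2 (hq.pow_ne_one_of_pos_of_lt (by omega) hn).symm
  -- The sequences live in A, but for n < N the recurrence can be divided by 1 - q^{n+1}, which
  -- forces them into the commutative subalgebra S. From n = N on, the rebuilt product carries an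
  -- inverse of 0 and is unrelated to f.
  have lift : ∀ (f : ℕ → A) (g : ℕ → S), f 0 = 1 →
      (∀ n, n + 1 < N → (1 - q ^ (n + 1)) • f (n + 1) = f n * (g n : A)) →
      ∃ F : ℕ → S, F 0 = 1 ∧ (∀ n, n + 1 < N → (1 - q ^ (n + 1)) • F (n + 1) = F n * g n) ∧
        ∀ n, n < N → (F n : A) = f n := by
    intro f g hf0 hf
    refine ⟨fun n => ∏ i ∈ Finset.range n, ((1 - q ^ (i + 1))⁻¹ • g i), by simp, fun n hn => ?_,
      fun n hn => ?_⟩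
    · beta_reduce
      rw [Finset.prod_range_succ, mul_smul_comm, smul_smul, mul_inv_cancel₀ (hne n hn), one_smul]
    · induction n with
      | zero => simp [hf0]
      | succ n ih =>
        beta_reduce at ih ⊢
        rw [Finset.prod_range_succ]
        have e := hf n hn
        have ih := ih (by omega)
        simp only [Subalgebra.coe_mul, Subalgebra.coe_smul] at ih ⊢
        rw [ih, mul_smul_comm, ← e, smul_smul, inv_mul_cancel₀ (hne n hn), one_smul]
  obtain ⟨L, hL0, hL, hLl⟩ := lift l (fun n => 1 - q ^ n • s + q ^ (2 * n + 1) • c) hl0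
    (fun n hn => by simpa [s, c] using hl n hn)
  obtain ⟨M, hM0, hM, hMm⟩ := lift m
    (fun n => c - q ^ n • s + algebraMap ℂ S (q ^ (2 * n + 1))) hm0
    (fun n hn => by simpa [s, c] using hm n hn)
  have key := congrArg S.val (sum_eq_sum_of_recurrences hq s c L M hL0 hM0 hL hM)
  simp only [map_sum, map_smul, map_mul, map_pow] at key
  calc _ = _ := Finset.sum_congr rfl fun n hn => by
        rw [← hLl n (Finset.mem_range.1 hn)]; rfl
    _ = _ := key
    _ = _ := Finset.sum_congr rfl fun n hn => by
        rw [← hMm n (Finset.mem_range.1 hn)]; rfl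

end QCommute

/-! ### The coefficients of Ř. -/

namespace QuantumSl2

open QCommute

/-- The coefficients of the truncated R-matrix. -/
noncomputable def rCoeff (ℓ n : ℕ) : ℂ := qn ℓ 1 ^ n / qfact (xi ℓ (-2)) n

theorem rCoeff_zero (ℓ : ℕ) : rCoeff ℓ 0 = 1 := by simp [rCoeff, qfact_zero]

theorem xi_two_pow_mul (ℓ n : ℕ) : xi ℓ 2 ^ n * xi ℓ (-2) ^ n = 1 := by
  rw [← mul_pow, xi_mul_neg, one_pow]

/-- `{n+1} = {1} ξ^n [n+1]`. -/
theorem qn_natCast_add_one (ℓ n : ℕ) :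
    qn ℓ (n + 1) = qn ℓ 1 * xi ℓ n * qint (xi ℓ (-2)) (n + 1) := by
  have h := one_sub_mul_qint (xi ℓ (-2)) (n + 1)
  rw [← xi_natCast_mul] at h
  have e1 : qn ℓ 1 = xi ℓ 1 * (1 - xi ℓ (-2)) := by
    rw [mul_sub, mul_one, ← xi_add, qn]; congr 2; norm_num
  have e2 : qn ℓ (n + 1) = xi ℓ 1 * xi ℓ n * (1 - xi ℓ ((n + 1 : ℕ) * -2)) := by
    rw [mul_sub, mul_one, ← xi_add, ← xi_add, qn, add_comm]; congr 2; push_cast; ring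
  rw [e1, e2, ← h]; ring

theorem qnFactorial_eq (ℓ n : ℕ) :
    qnFactorial ℓ n = qn ℓ 1 ^ n * xi ℓ ((n : ℂ) * ((n : ℂ) - 1) / 2) * qfact (xi ℓ (-2)) n := by
  induction n with
  | zero => simp [qnFactorial, qfact_zero, xi_zero]
  | succ n ih =>
    rw [qnFactorial, Finset.prod_range_succ, ← qnFactorial, ih, qfact_succ, qn_natCast_add_one,
      show ((n + 1 : ℕ) : ℂ) * ((n + 1 : ℕ) - 1) / 2 = (n : ℂ) * (n - 1) / 2 + n by
        push_cast; ring, xi_add]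
    ring

theorem rCoeff_eq {ℓ : ℕ} (hℓ : 3 ≤ ℓ) (n : ℕ) :
    qn ℓ 1 ^ (2 * n) / qnFactorial ℓ n * xi ℓ ((n : ℂ) * ((n : ℂ) - 1) / 2) = rCoeff ℓ n := by
  have h1 := qn_one_ne_zero hℓ
  have h2 := xi_ne_zero ℓ ((n : ℂ) * ((n : ℂ) - 1) / 2)
  rw [qnFactorial_eq, rCoeff]
  -- When the q-factorial vanishes, both sides are 0 because division by 0 gives 0.
  rcases eq_or_ne (qfact (xi ℓ (-2)) n) 0 with h | h
  · simp [h]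
  · field_simp
    ring

/-- The factor [n+1]/{1} is the one in [E, F^{n+1}] and [E^{n+1}, F]; this relation makes the
intertwiner sums telescope. -/
theorem rCoeff_succ_mul {ℓ : ℕ} (hℓ : 3 ≤ ℓ) {n : ℕ} (hn : n + 1 < ell' ℓ) :
    rCoeff ℓ (n + 1) * (qint (xi ℓ (-2)) (n + 1) / qn ℓ 1) = rCoeff ℓ n := by
  have h := isPrimitiveRoot_xi_neg_two (ℓ := ℓ) (by omega)
  have h1 := qint_ne_zero h (Nat.succ_pos n) hn
  have h2 := qfact_ne_zero h (show n < ell' ℓ by omega)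
  have h3 := qn_one_ne_zero hℓ
  rw [rCoeff, rCoeff, qfact_succ]
  field_simp
  ring

/-- The recursion rewritten for q = ξ² instead of ξ^{-2}, in the shape required by
`sum_eq_sum_of_recurrences'`. -/
theorem one_sub_mul_rCoeff_succ {ℓ : ℕ} (hℓ : ℓ ≠ 0) {n : ℕ} (hn : n + 1 < ell' ℓ) :
    (1 - xi ℓ 2 ^ (n + 1)) * rCoeff ℓ (n + 1) =
      -(rCoeff ℓ n * qn ℓ 1 ^ 2 * xi ℓ 2 ^ n * xi ℓ 1) := by
  have h := isPrimitiveRoot_xi_neg_two hℓ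
  have h1 := qint_ne_zero h (Nat.succ_pos n) hn
  have h2 := qfact_ne_zero h (show n < ell' ℓ by omega)
  have h3 := one_sub_mul_qint (xi ℓ (-2)) (n + 1)
  have h4 := xi_two_pow_mul ℓ (n + 1)
  have e1 : xi ℓ 1 * qn ℓ 1 = xi ℓ 2 * (1 - xi ℓ (-2)) := by
    rw [qn, mul_sub, mul_sub, xi_mul_neg, xi_mul_neg, mul_one, ← xi_add]; norm_num
  rw [rCoeff, rCoeff, qfact_succ]
  field_simp
  linear_combination qn ℓ 1 ^ (n + 1) * (xi ℓ 2 ^ n * qint (xi ℓ (-2)) (n + 1) * e1 +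
    xi ℓ 2 ^ (n + 1) * h3 - h4)

/-! ### Commutation of powers of E, F and K. -/

namespace UK

variable {ℓ : ℕ} {B : Type*} [Ring B] [Algebra ℂ B] {e f : B} {k : ℂ → B}

theorem Sat.k_e_pow (h : Sat ℓ e f k) (α : ℂ) (n : ℕ) :
    k α * e ^ n = xi ℓ (2 * α * n) • (e ^ n * k α) := by
  rw [pow_mul_eq (h.k_e α), ← xi_natCast_mul, mul_comm]

theorem Sat.k_f_pow (h : Sat ℓ e f k) (α : ℂ) (n : ℕ) :
    k α * f ^ n = xi ℓ (-2 * α * n) • (f ^ n * k α) := by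
  rw [pow_mul_eq (h.k_f α), ← xi_natCast_mul, mul_comm]

theorem Sat.k_comm (h : Sat ℓ e f k) (x y : ℂ) : Commute (k x) (k y) := by
  rw [commute_iff_eq, h.k_mul, h.k_mul, add_comm]

/-- Induction by the Leibniz rule for [E, ·]. The K and K^{-1} components use the two different
recursions `qint_succ'` and `qint_succ`. -/
theorem Sat.e_mul_f_pow (h : Sat ℓ e f k) (n : ℕ) :
    e * f ^ (n + 1) - f ^ (n + 1) * e = (qint (xi ℓ (-2)) (n + 1) / qn ℓ 1) •
      (f ^ n * k 1 - k (-1) * f ^ n) := by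
  have hk : ∀ n : ℕ, k (-1) * f ^ n = xi ℓ 2 ^ n • (f ^ n * k (-1)) := fun n => by
    rw [h.k_f_pow, ← xi_natCast_mul]; congr 2; ring
  have h1 : k 1 * f = xi ℓ (-2) • (f * k 1) := by simpa using h.k_f 1
  have h2 : k (-1) * f = xi ℓ 2 • (f * k (-1)) := by simpa using hk 1
  induction n with
  | zero =>
    have := h.e_f
    simp only [zero_add, pow_one, pow_zero, one_mul, mul_one, this]
    simp [qint, qn]
  | succ n ih =>
    rw [hk] at ih ⊢
    have e1 : e * f ^ (n + 1 + 1) - f ^ (n + 1 + 1) * e =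
        (e * f ^ (n + 1) - f ^ (n + 1) * e) * f + f ^ (n + 1) * (e * f - f * e) := by
      rw [pow_succ f (n + 1)]; noncomm_ring
    have e2 : f ^ n * k 1 * f = xi ℓ (-2) • (f ^ (n + 1) * k 1) := by
      rw [mul_assoc, h1, mul_smul_comm, ← mul_assoc, pow_succ]
    have e3 : f ^ n * k (-1) * f = xi ℓ 2 • (f ^ (n + 1) * k (-1)) := by
      rw [mul_assoc, h2, mul_smul_comm, ← mul_assoc, pow_succ]
    have a1 := qint_succ (xi ℓ (-2)) (n + 1)
    have a2 := qint_succ' (xi ℓ (-2)) (n + 1)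
    have a3 := xi_two_pow_mul ℓ (n + 1)
    rw [e1, ih, h.e_f, smul_mul_assoc, sub_mul, smul_mul_assoc, e2, e3, mul_smul_comm, mul_sub,
      ← qn]
    generalize qint (xi ℓ (-2)) (n + 1 + 1) = Q at *
    match_scalars
    · linear_combination -(qn ℓ 1)⁻¹ * a2
    · linear_combination (qn ℓ 1)⁻¹ * xi ℓ 2 ^ (n + 1) * a1 + (qn ℓ 1)⁻¹ * a3

theorem Sat.e_pow_mul_f (h : Sat ℓ e f k) (n : ℕ) :
    e ^ (n + 1) * f - f * e ^ (n + 1) = (qint (xi ℓ (-2)) (n + 1) / qn ℓ 1) •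
      (k 1 * e ^ n - e ^ n * k (-1)) := by
  have hk : ∀ n : ℕ, k 1 * e ^ n = xi ℓ 2 ^ n • (e ^ n * k 1) := fun n => by
    rw [h.k_e_pow, ← xi_natCast_mul]; congr 2; ring
  have h1 : k 1 * e = xi ℓ 2 • (e * k 1) := by simpa using hk 1
  have h2 : k (-1) * e = xi ℓ (-2) • (e * k (-1)) := by simpa using h.k_e (-1)
  induction n with
  | zero =>
    have := h.e_f
    simp only [zero_add, pow_one, pow_zero, one_mul, mul_one, this]
    simp [qint, qn]
  | succ n ih =>
    rw [hk] at ih ⊢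
    have e1 : e ^ (n + 1 + 1) * f - f * e ^ (n + 1 + 1) =
        (e ^ (n + 1) * f - f * e ^ (n + 1)) * e + e ^ (n + 1) * (e * f - f * e) := by
      rw [pow_succ e (n + 1)]; noncomm_ring
    have e2 : e ^ n * k 1 * e = xi ℓ 2 • (e ^ (n + 1) * k 1) := by
      rw [mul_assoc, h1, mul_smul_comm, ← mul_assoc, pow_succ]
    have e3 : e ^ n * k (-1) * e = xi ℓ (-2) • (e ^ (n + 1) * k (-1)) := by
      rw [mul_assoc, h2, mul_smul_comm, ← mul_assoc, pow_succ]
    have a1 := qint_succ (xi ℓ (-2)) (n + 1)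
    have a2 := qint_succ' (xi ℓ (-2)) (n + 1)
    have a3 := xi_two_pow_mul ℓ (n + 1)
    rw [e1, ih, h.e_f, smul_mul_assoc, sub_mul, smul_mul_assoc, e2, e3, mul_smul_comm, mul_sub,
      ← qn]
    generalize qint (xi ℓ (-2)) (n + 1 + 1) = Q at *
    match_scalars
    · linear_combination -(qn ℓ 1)⁻¹ * xi ℓ 2 ^ (n + 1) * a1 - (qn ℓ 1)⁻¹ * a3
    · linear_combination (qn ℓ 1)⁻¹ * a2

/-! ### The intertwining property of Ř. -/

section Intertwiner

variable {C : Type*} [Ring C] [Algebra ℂ C] {e' f' : C} {k' : ℂ → C}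

/-- `∑ c_n E^n ⊗ F^n`. -/
noncomputable def truncated (ℓ : ℕ) (e : B) (f' : C) : B ⊗[ℂ] C :=
  ∑ n ∈ Finset.range (ell' ℓ), rCoeff ℓ n • ((e ^ n) ⊗ₜ[ℂ] (f' ^ n))

theorem sum_telescope {M : Type*} [AddCommGroup M] {N : ℕ} (s t : ℕ → M) (h0 : s 0 = 0)
    (ht : t (N - 1) = 0) (h : ∀ n, n + 1 < N → s (n + 1) = t n) :
    ∑ n ∈ Finset.range N, s n = ∑ n ∈ Finset.range N, t n := by
  cases N with
  | zero => simp
  | succ N =>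
    rw [Finset.sum_range_succ', Finset.sum_range_succ _ N, h0, show t N = 0 from ht]
    congr 1
    exact Finset.sum_congr rfl fun n hn => h n (by have := Finset.mem_range.1 hn; omega)

/-- The right-hand factor is the opposite coproduct of E before conjugation by the Cartan part. Term
n+1 of [1 ⊗ E, Ř] equals term n of Ř (E ⊗ K) - (E ⊗ K^{-1}) Ř. The ends vanish since [E, F^0] = 0
and E^{ℓ'} = 0. -/
theorem truncated_mul_e (hℓ : 3 ≤ ℓ) (h : Sat ℓ e f k) (h' : Sat ℓ e' f' k') :
    truncated ℓ e f' * ((1 : B) ⊗ₜ[ℂ] e' + e ⊗ₜ[ℂ] k' 1) =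
      (e ⊗ₜ[ℂ] k' (-1) + (1 : B) ⊗ₜ[ℂ] e') * truncated ℓ e f' := by
  have hN := ell'_ne_zero (ℓ := ℓ) (by omega)
  have key := sum_telescope (N := ell' ℓ)
    (fun n => rCoeff ℓ n • ((e ^ n) ⊗ₜ[ℂ] (e' * f' ^ n - f' ^ n * e')))
    (fun n => rCoeff ℓ n • ((e ^ (n + 1)) ⊗ₜ[ℂ] (f' ^ n * k' 1 - k' (-1) * f' ^ n))) (by simp)
    (by simp [Nat.sub_add_cancel (Nat.one_le_iff_ne_zero.2 hN), h.e_pow])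
    (fun n hn => by
      simp only [h'.e_mul_f_pow, TensorProduct.tmul_smul, smul_smul, rCoeff_succ_mul hℓ hn])
  rw [truncated, Finset.sum_mul, Finset.mul_sum, ← sub_eq_zero, ← Finset.sum_sub_distrib]
  rw [← sub_eq_zero, ← Finset.sum_sub_distrib, ← neg_eq_zero, ← Finset.sum_neg_distrib] at key
  rw [← key]
  refine Finset.sum_congr rfl fun n _ => ?_
  simp only [mul_add, add_mul, smul_mul_assoc, mul_smul_comm, Algebra.TensorProduct.tmul_mul_tmul,
    mul_one, one_mul, TensorProduct.tmul_sub, ← pow_succ, ← pow_succ']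
  module

theorem truncated_mul_f (hℓ : 3 ≤ ℓ) (h : Sat ℓ e f k) (h' : Sat ℓ e' f' k') :
    truncated ℓ e f' * (k (-1) ⊗ₜ[ℂ] f' + f ⊗ₜ[ℂ] (1 : C)) =
      (f ⊗ₜ[ℂ] (1 : C) + k 1 ⊗ₜ[ℂ] f') * truncated ℓ e f' := by
  have hN := ell'_ne_zero (ℓ := ℓ) (by omega)
  have key := sum_telescope (N := ell' ℓ)
    (fun n => rCoeff ℓ n • ((e ^ n * f - f * e ^ n) ⊗ₜ[ℂ] (f' ^ n)))
    (fun n => rCoeff ℓ n • ((k 1 * e ^ n - e ^ n * k (-1)) ⊗ₜ[ℂ] (f' ^ (n + 1)))) (by simp)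
    (by simp [Nat.sub_add_cancel (Nat.one_le_iff_ne_zero.2 hN), h'.f_pow])
    (fun n hn => by
      simp only [h.e_pow_mul_f, ← TensorProduct.smul_tmul', smul_smul, rCoeff_succ_mul hℓ hn])
  rw [truncated, Finset.sum_mul, Finset.mul_sum, ← sub_eq_zero, ← Finset.sum_sub_distrib]
  rw [← sub_eq_zero, ← Finset.sum_sub_distrib] at key
  rw [← key]
  refine Finset.sum_congr rfl fun n _ => ?_
  simp only [mul_add, add_mul, smul_mul_assoc, mul_smul_comm, Algebra.TensorProduct.tmul_mul_tmul,
    mul_one, one_mul, TensorProduct.sub_tmul, ← pow_succ, ← pow_succ']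
  module

end Intertwiner

/-! ### The Casimir element and the twist identity. -/

section Casimir

/-- `{1}² F E + ξ K + ξ⁻¹ K⁻¹`. -/
noncomputable def casimir (ℓ : ℕ) (e f : B) (k : ℂ → B) : B :=
  qn ℓ 1 ^ 2 • (f * e) + xi ℓ 1 • k 1 + xi ℓ (-1) • k (-1)

theorem Sat.casimir_eq (hd : qn ℓ 1 ≠ 0) (h : Sat ℓ e f k) :
    casimir ℓ e f k = qn ℓ 1 ^ 2 • (e * f) + xi ℓ (-1) • k 1 + xi ℓ 1 • k (-1) := by
  have := h.e_f
  rw [← qn, sub_eq_iff_eq_add] at this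
  rw [casimir, this]
  match_scalars
  · rfl
  · rw [pow_two, mul_assoc, mul_inv_cancel_left₀ hd, qn]; ring
  · rw [pow_two, mul_assoc, mul_inv_cancel_left₀ hd, qn]; ring

theorem Sat.casimir_comm_k (h : Sat ℓ e f k) (α : ℂ) : Commute (casimir ℓ e f k) (k α) := by
  have h1 : Commute (f * e) (k α) := by
    rw [commute_iff_eq, ← mul_assoc, h.k_f, smul_mul_assoc, mul_assoc, mul_assoc, h.k_e,
      mul_smul_comm, smul_smul, ← xi_add]
    simp [xi_zero]
  exact ((h1.smul_left _).add_left ((h.k_comm _ _).smul_left _)).add_left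
    ((h.k_comm _ _).smul_left _)

/-- The FE form of the Casimir is used on one side and the EF form on the other, so that both
contain the monomial F E F. -/
theorem Sat.casimir_comm_f (hd : qn ℓ 1 ≠ 0) (h : Sat ℓ e f k) : Commute (casimir ℓ e f k) f := by
  have h1 : k 1 * f = xi ℓ (-2) • (f * k 1) := by simpa using h.k_f 1
  have h2 : k (-1) * f = xi ℓ 2 • (f * k (-1)) := by simpa using h.k_f (-1)
  have a1 : xi ℓ 1 * xi ℓ (-2) = xi ℓ (-1) := by rw [← xi_add]; norm_num
  have a2 : xi ℓ (-1) * xi ℓ 2 = xi ℓ 1 := by rw [← xi_add]; norm_num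
  rw [commute_iff_eq]
  nth_rw 2 [h.casimir_eq hd]
  simp only [casimir, add_mul, mul_add, smul_mul_assoc, mul_smul_comm, h1, h2, smul_smul, a1, a2,
    mul_assoc]

theorem Sat.casimir_comm_e (hd : qn ℓ 1 ≠ 0) (h : Sat ℓ e f k) : Commute (casimir ℓ e f k) e := by
  have h1 : k 1 * e = xi ℓ 2 • (e * k 1) := by simpa using h.k_e 1
  have h2 : k (-1) * e = xi ℓ (-2) • (e * k (-1)) := by simpa using h.k_e (-1)
  have a1 : xi ℓ 1 * xi ℓ (-2) = xi ℓ (-1) := by rw [← xi_add]; norm_num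
  have a2 : xi ℓ (-1) * xi ℓ 2 = xi ℓ 1 := by rw [← xi_add]; norm_num
  rw [commute_iff_eq]
  nth_rw 1 [h.casimir_eq hd]
  simp only [casimir, add_mul, mul_add, smul_mul_assoc, mul_smul_comm, h1, h2, smul_smul, a1, a2,
    mul_assoc]

/-- The innermost E F is linear in the Casimir, K and K^{-1}; moving it past F^n only rescales K and
K^{-1}. By iteration, E^n F^n is a product of commuting linear factors. -/
theorem Sat.e_pow_f_pow_succ (hd : qn ℓ 1 ≠ 0) (h : Sat ℓ e f k) (n : ℕ) :
    qn ℓ 1 ^ 2 • (e ^ (n + 1) * f ^ (n + 1)) = e ^ n * f ^ n * (casimir ℓ e f k -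
      (xi ℓ (-1) * xi ℓ (-2) ^ n) • k 1 - (xi ℓ 1 * xi ℓ 2 ^ n) • k (-1)) := by
  have h0 := h.casimir_eq hd
  have hC := (h.casimir_comm_f hd).pow_right n
  have h1 : k 1 * f ^ n = xi ℓ (-2) ^ n • (f ^ n * k 1) := by
    rw [h.k_f_pow, ← xi_natCast_mul]; congr 2; ring
  have h2 : k (-1) * f ^ n = xi ℓ 2 ^ n • (f ^ n * k (-1)) := by
    rw [h.k_f_pow, ← xi_natCast_mul]; congr 2; ring
  have h3 : qn ℓ 1 ^ 2 • (e * f) = casimir ℓ e f k - xi ℓ (-1) • k 1 - xi ℓ 1 • k (-1) := by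
    rw [h0]; abel
  rw [pow_succ e, pow_succ' f, mul_assoc, ← mul_assoc e, ← mul_smul_comm, ← smul_mul_assoc, h3,
    mul_assoc]
  congr 1
  simp only [sub_mul, mul_sub, smul_mul_assoc, mul_smul_comm, h1, h2, smul_smul, hC.eq]

theorem Sat.f_pow_e_pow_succ (hd : qn ℓ 1 ≠ 0) (h : Sat ℓ e f k) (n : ℕ) :
    qn ℓ 1 ^ 2 • (f ^ (n + 1) * e ^ (n + 1)) = f ^ n * e ^ n * (casimir ℓ e f k -
      (xi ℓ 1 * xi ℓ 2 ^ n) • k 1 - (xi ℓ (-1) * xi ℓ (-2) ^ n) • k (-1)) := by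
  have hC := (h.casimir_comm_e hd).pow_right n
  have h1 : k 1 * e ^ n = xi ℓ 2 ^ n • (e ^ n * k 1) := by
    rw [h.k_e_pow, ← xi_natCast_mul]; congr 2; ring
  have h2 : k (-1) * e ^ n = xi ℓ (-2) ^ n • (e ^ n * k (-1)) := by
    rw [h.k_e_pow, ← xi_natCast_mul]; congr 2; ring
  have h3 : qn ℓ 1 ^ 2 • (f * e) = casimir ℓ e f k - xi ℓ 1 • k 1 - xi ℓ (-1) • k (-1) := by
    rw [casimir]; abel
  rw [pow_succ f, pow_succ' e, mul_assoc, ← mul_assoc f, ← mul_smul_comm, ← smul_mul_assoc, h3,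
    mul_assoc]
  congr 1
  simp only [sub_mul, mul_sub, smul_mul_assoc, mul_smul_comm, h1, h2, smul_smul, hC.eq]

theorem Sat.k_pow (h : Sat ℓ e f k) (x : ℂ) (n : ℕ) : k x ^ n = k (n * x) := by
  induction n with
  | zero => simp [h.k_zero]
  | succ n ih => rw [pow_succ, ih, h.k_mul]; congr 1; push_cast; ring

/-- The identity behind the equality of the two twists. -/
theorem Sat.twist_sum (hℓ : 3 ≤ ℓ) (h : Sat ℓ e f k) :
    ∑ n ∈ Finset.range (ell' ℓ), (rCoeff ℓ n * xi ℓ 2 ^ n) • (f ^ n * e ^ n * k n) *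
        k (1 - ell' ℓ) =
      ∑ n ∈ Finset.range (ell' ℓ), (rCoeff ℓ n * xi ℓ 2 ^ n) • (e ^ n * f ^ n * k (-n)) *
        k (-(1 - ell' ℓ)) := by
  have hℓ0 : ℓ ≠ 0 := by omega
  have hd := qn_one_ne_zero hℓ
  set C := casimir ℓ e f k with hC
  have a1 := xi_mul_neg ℓ 1
  have a2 : xi ℓ 1 * xi ℓ 1 = xi ℓ 2 := by rw [← xi_add]; norm_num
  have hk1 : ∀ n : ℕ, k (-(n + 1 : ℕ)) = k (-1) * k (-n) := fun n => by
    rw [h.k_mul]; congr 1; push_cast; ring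
  have hk2 : k 1 * k (-1) = 1 := h.k_neg 1
  have hk3 : k (-1) * k (-1) = k (-2) := by rw [h.k_mul]; norm_num
  -- One recurrence serves both orderings: x and y are consecutive products, and Z is the linear
  -- factor in the Casimir, K and K^{-1} relating them.
  have hrec : ∀ (n : ℕ) (x y Z : B), n + 1 < ell' ℓ → qn ℓ 1 ^ 2 • y = x * Z → Commute Z (k (-n)) →
      (1 - xi ℓ 2 ^ (n + 1)) • rCoeff ℓ (n + 1) • (y * k (-(n + 1 : ℕ))) =
        rCoeff ℓ n • (x * k (-n)) * (-(xi ℓ 2 ^ n * xi ℓ 1) • (Z * k (-1))) := by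
    intro n x y Z hn hy hZ
    rw [smul_smul, one_sub_mul_rCoeff_succ hℓ0 hn, smul_mul_smul_comm, hk1, mul_assoc x,
      ← mul_assoc (k (-n)), ← hZ.eq, mul_assoc Z, (h.k_comm (-n) (-1)).eq, ← mul_assoc x, ← hy,
      smul_mul_assoc, smul_smul]
    congr 1; ring
  have hσ : Commute (xi ℓ 1 • (C * k (-1))) (k (-2)) :=
    ((h.casimir_comm_k _).mul_left (h.k_comm _ _)).smul_left _
  have hcomm : ∀ (x y : ℂ) (n : ℕ), Commute (C - x • k 1 - y • k (-1)) (k (-n)) := fun x y n =>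
    ((h.casimir_comm_k _).sub_left ((h.k_comm _ _).smul_left _)).sub_left
      ((h.k_comm _ _).smul_left _)
  -- Here q = ξ², σ = ξ C K^{-1} and κ = K^{-2}. Expanding -q^n ξ Z K^{-1} gives 1 - q^n σ +
  -- q^{2n+1} κ for E^n F^n, and κ - q^n σ + q^{2n+1} for F^n E^n.
  have key := sum_eq_sum_of_recurrences' (isPrimitiveRoot_xi_two hℓ0) hσ
    (fun n => rCoeff ℓ n • (e ^ n * f ^ n * k (-n)))
    (fun n => rCoeff ℓ n • (f ^ n * e ^ n * k (-n)))
    (by simp [rCoeff_zero, h.k_zero]) (by simp [rCoeff_zero, h.k_zero])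
    (fun n hn => by
      rw [hrec n _ _ _ hn (h.e_pow_f_pow_succ hd n) (hcomm _ _ n)]
      congr 1
      rw [sub_mul, sub_mul, smul_mul_assoc, smul_mul_assoc, hk2, hk3]
      have a3 := xi_two_pow_mul ℓ n
      match_scalars
      · ring
      · linear_combination a1 * xi ℓ 2 ^ n * xi ℓ (-2) ^ n + a3
      · linear_combination a2 * xi ℓ 2 ^ (2 * n))
    (fun n hn => by
      rw [hrec n _ _ _ hn (h.f_pow_e_pow_succ hd n) (hcomm _ _ n)]
      congr 1
      rw [sub_mul, sub_mul, smul_mul_assoc, smul_mul_assoc, hk2, hk3, Algebra.algebraMap_eq_smul_one]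
      have a3 := xi_two_pow_mul ℓ n
      match_scalars
      · ring
      · linear_combination a2 * xi ℓ 2 ^ (2 * n)
      · linear_combination a1 * xi ℓ 2 ^ n * xi ℓ (-2) ^ n + a3)
  -- This is where the exponent 1 - ℓ' of the pivot enters: K^{-n} κ^{ℓ'-1-n} = K^n K^{2(1-ℓ')}, so
  -- multiplying by K^{-(1-ℓ')} leaves K^n K^{1-ℓ'}.
  have key := congrArg (· * k (-(1 - ell' ℓ))) key
  simp only [Finset.sum_mul] at key
  rw [eq_comm]
  calc _ = _ := Finset.sum_congr rfl fun n _ => by rw [smul_smul, mul_comm (rCoeff ℓ n)]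
    _ = _ := key
    _ = _ := Finset.sum_congr rfl fun n hn => by
        have hn := Finset.mem_range.1 hn
        have hc : ((ell' ℓ - 1 - n : ℕ) : ℂ) = ell' ℓ - 1 - n := by
          rw [Nat.cast_sub (by omega), Nat.cast_sub (by omega)]; simp
        rw [h.k_pow, hc, smul_mul_assoc, smul_mul_assoc, smul_mul_assoc, smul_smul, smul_mul_assoc,
          mul_comm (rCoeff ℓ n)]
        simp only [mul_assoc, h.k_mul]
        congr 4; ring

end Casimir

end UK

end QuantumSl2

/-! ### The R-matrix axioms in U_a ⊗ U_b. -/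

namespace QuantumSl2

open QCommute

/-- Translating the window of s by -d absorbs the character ξ^{2td} and leaves the factor u(d). -/
theorem sum_xi_smul_mul {ℓ : ℕ} {B : Type*} [Ring B] [Algebra ℂ B] {u : ℂ → B} {α : ℂ}
    (hℓ : ℓ ≠ 0) (hu : IsToral ℓ u α) (d : ℤ) :
    (1 / (ell' ℓ : ℂ)) • ∑ i ∈ Finset.range (ell' ℓ), ∑ j ∈ Finset.range (ell' ℓ),
      xi ℓ (-2 * (α + i) * (α + j) + 2 * (α + i) * d) • (u (α + i) * u (α + j)) =
      pairing ℓ u u α α * u d := by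
  rw [pairing, smul_mul_assoc, Finset.sum_mul]
  congr 1
  refine Finset.sum_congr rfl fun i _ => ?_
  have e := sum_range_shift (ell' ℓ) (fun s => xi ℓ (-2 * s * (α + i)) • (u s * (u (α + i) * u d)))
    (periodic_left hℓ hu i _) α (-d)
  rw [Finset.sum_mul]
  refine Eq.trans (Finset.sum_congr rfl fun j _ => ?_) (e.trans (Finset.sum_congr rfl fun j _ => ?_))
  · rw [hu.mul, hu.mul, hu.mul]
    congr 2
    · push_cast; ring
    · push_cast; ring
  · rw [smul_mul_assoc, hu.mul, hu.mul, hu.mul, hu.mul]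
    congr 2 <;> ring_nf

namespace U

variable {ℓ : ℕ}

theorem isToral_K {a : G} {α : ℂ} (h : IsHalf α a) : IsToral ℓ (K ℓ a) α where
  mul := (sat ℓ a).k_mul
  zero := (sat ℓ a).k_zero
  period := by
    have h1 := K_half (ℓ := ℓ) a _ h
    rw [Algebra.algebraMap_eq_smul_one] at h1
    have h2 := Nat.gcd_dvd_right ℓ 2
    -- For ℓ odd, ℓ' = ℓ and the relation K^{ℓ/2} = ξ^{ℓα} must be squared; for ℓ even, ℓ' = ℓ/2 and
    -- it is the claim itself.
    rcases (Nat.dvd_prime Nat.prime_two).1 h2 with h3 | h3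
    · have e : ell' ℓ = ℓ := by rw [ell', h3, Nat.div_one]
      rw [e]
      have := (sat ℓ a).k_mul ((ℓ : ℂ) / 2) (ℓ / 2)
      rw [add_halves, h1, smul_mul_smul_comm, one_mul, ← xi_add] at this
      rw [← this]; congr 2; ring
    · have e : ell' ℓ * 2 = ℓ := by
        rw [ell', h3]; exact Nat.div_mul_cancel (h3 ▸ Nat.gcd_dvd_left ℓ 2)
      have e' : (ell' ℓ : ℂ) = ℓ / 2 := by
        have : ((ell' ℓ * 2 : ℕ) : ℂ) = ℓ := by rw [e]
        push_cast at this
        linear_combination this / 2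
      rw [e', h1]; congr 2; ring

theorem commute_tmul_one_one_tmul {A B : Type*} [Ring A] [Algebra ℂ A] [Ring B] [Algebra ℂ B]
    (x : A) (y : B) : Commute (x ⊗ₜ[ℂ] (1 : B)) ((1 : A) ⊗ₜ[ℂ] y) := by
  simp [commute_iff_eq]

theorem cartanSum_eq_pairing (a b : G) (α β : ℂ) :
    cartanSum ℓ a b α β =
      pairing ℓ (fun t => K ℓ a t ⊗ₜ[ℂ] (1 : U ℓ b)) (fun s => (1 : U ℓ a) ⊗ₜ[ℂ] K ℓ b s) α β := by
  simp [cartanSum, pairing, add_comm]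

theorem isToral_left {a : G} {α : ℂ} (h : IsHalf α a) (b : G) :
    IsToral ℓ (fun t => K ℓ a t ⊗ₜ[ℂ] (1 : U ℓ b)) α :=
  (isToral_K h).map Algebra.TensorProduct.includeLeft

theorem isToral_right {b : G} {β : ℂ} (h : IsHalf β b) (a : G) :
    IsToral ℓ (fun s => (1 : U ℓ a) ⊗ₜ[ℂ] K ℓ b s) β :=
  (isToral_K h).map (Algebra.TensorProduct.includeRight : U ℓ b →ₐ[ℂ] U ℓ a ⊗[ℂ] U ℓ b)

theorem IsHalf.exists_eq_add {a : G} {α β : ℂ} (h : IsHalf α a) (h' : IsHalf β a) :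
    ∃ k : ℤ, α = β + k := by
  have := QuotientAddGroup.eq.1 (h'.trans h.symm)
  obtain ⟨k, hk⟩ := AddSubgroup.mem_zmultiples_iff.1 this
  refine ⟨k, ?_⟩
  rw [zsmul_eq_mul] at hk
  linear_combination -hk / 2

theorem IsHalf.add {a b : G} {α β : ℂ} (h : IsHalf α a) (h' : IsHalf β b) :
    IsHalf (α + β) (a + b) := by
  rw [IsHalf, mul_add, QuotientAddGroup.mk_add, h, h']

theorem cartanSum_eq_cartan (hℓ : ℓ ≠ 0) {a b : G} {α β : ℂ} (hα : IsHalf α a) (hβ : IsHalf β b) :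
    cartanSum ℓ a b α β = cartan ℓ a b := by
  obtain ⟨k, rfl⟩ := hα.exists_eq_add (isHalf_out a)
  obtain ⟨l, rfl⟩ := hβ.exists_eq_add (isHalf_out b)
  rw [cartan, cartanSum_eq_pairing, cartanSum_eq_pairing]
  exact pairing_congr hℓ (isToral_left (isHalf_out a) b) (isToral_right (isHalf_out b) a)
    (fun _ _ => commute_tmul_one_one_tmul _ _) k l

theorem cartan_eq_pairing (hℓ : ℓ ≠ 0) {a b : G} {α β : ℂ} (hα : IsHalf α a) (hβ : IsHalf β b) :
    cartan ℓ a b =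
      pairing ℓ (fun t => K ℓ a t ⊗ₜ[ℂ] (1 : U ℓ b)) (fun s => (1 : U ℓ a) ⊗ₜ[ℂ] K ℓ b s) α β := by
  rw [← cartanSum_eq_cartan hℓ hα hβ, cartanSum_eq_pairing]

theorem truncatedR_eq_truncated (hℓ : 3 ≤ ℓ) (a b : G) :
    truncatedR ℓ a b = UK.truncated ℓ (E ℓ a) (F ℓ b) := by
  simp only [truncatedR, UK.truncated, rCoeff_eq hℓ]

theorem truncatedR_eq_qexp (hℓ : 3 ≤ ℓ) (a b : G) :
    truncatedR ℓ a b = qexp (xi ℓ (-2)) (ell' ℓ) (qn ℓ 1 • (E ℓ a ⊗ₜ[ℂ] F ℓ b)) := by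
  rw [truncatedR_eq_truncated hℓ, UK.truncated, qexp]
  refine Finset.sum_congr rfl fun n _ => ?_
  rw [smul_pow, smul_smul, Algebra.TensorProduct.tmul_pow, rCoeff, div_eq_inv_mul]

theorem isUnit_rMatrix (hℓ : 3 ≤ ℓ) (a b : G) : IsUnit (rMatrix ℓ a b) := by
  have hℓ0 : ℓ ≠ 0 := by omega
  refine IsUnit.mul ?_ ?_
  · rw [cartan_eq_pairing hℓ0 (isHalf_out a) (isHalf_out b)]
    exact isUnit_pairing hℓ0 (isToral_left (isHalf_out a) b) (isToral_right (isHalf_out b) a)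
      (fun _ _ => commute_tmul_one_one_tmul _ _)
  · rw [truncatedR_eq_qexp hℓ]
    refine isUnit_qexp _ (ell'_ne_zero hℓ0) ?_
    rw [smul_pow, Algebra.TensorProduct.tmul_pow, (sat ℓ a).e_pow, TensorProduct.zero_tmul,
      smul_zero]

/-- With its mirror image, this yields the four conjugation rules that remove or create the factors
K^{±1} separating the twisted coproduct from the opposite one. -/
theorem cartan_mul_left (hℓ : ℓ ≠ 0) {a b : G} {x : U ℓ a} {y : U ℓ b} (d : ℤ)
    (hx : ∀ t, K ℓ a t * x = xi ℓ (2 * t * d) • (x * K ℓ a t)) (hy : ∀ s, Commute (K ℓ b s) y) :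
    cartan ℓ a b * x ⊗ₜ y = x ⊗ₜ (y * K ℓ b d) * cartan ℓ a b := by
  rw [cartan_eq_pairing hℓ (isHalf_out a) (isHalf_out b),
    pairing_mul_of_weight hℓ (isToral_right (isHalf_out b) a)
    (fun _ _ => commute_tmul_one_one_tmul _ _) d]
  · simp
  · intro t; simp [hx, TensorProduct.smul_tmul']
  · intro s; simp [commute_iff_eq, (hy s).eq]

theorem cartan_mul_right (hℓ : ℓ ≠ 0) {a b : G} {x : U ℓ a} {y : U ℓ b} (d : ℤ)
    (hy : ∀ t, K ℓ b t * y = xi ℓ (2 * t * d) • (y * K ℓ b t)) (hx : ∀ s, Commute (K ℓ a s) x) :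
    cartan ℓ a b * x ⊗ₜ y = (x * K ℓ a d) ⊗ₜ y * cartan ℓ a b := by
  rw [cartan_eq_pairing hℓ (isHalf_out a) (isHalf_out b),
    pairing_comm (fun _ _ => commute_tmul_one_one_tmul _ _),
    pairing_mul_of_weight hℓ (isToral_left (isHalf_out a) b)
    (fun _ _ => (commute_tmul_one_one_tmul _ _).symm) d]
  · simp
  · intro t; simp [hy]
  · intro s; simp [commute_iff_eq, (hx s).eq]

theorem weight_E (a : G) (t : ℂ) :
    K ℓ a t * E ℓ a = xi ℓ (2 * t * (1 : ℤ)) • (E ℓ a * K ℓ a t) := by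
  simpa using (sat ℓ a).k_e t

theorem weight_F (a : G) (t : ℂ) :
    K ℓ a t * F ℓ a = xi ℓ (2 * t * (-1 : ℤ)) • (F ℓ a * K ℓ a t) := by
  simpa using (sat ℓ a).k_f t

theorem cartan_mul_E_tmul (hℓ : ℓ ≠ 0) (a b : G) :
    cartan ℓ a b * E ℓ a ⊗ₜ K ℓ b (-1) = E ℓ a ⊗ₜ 1 * cartan ℓ a b := by
  rw [cartan_mul_left hℓ 1 (weight_E a) (fun s => (sat ℓ b).k_comm _ _), Int.cast_one,
    (sat ℓ b).k_neg' 1]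

theorem cartan_mul_tmul_E (hℓ : ℓ ≠ 0) (a b : G) :
    cartan ℓ a b * 1 ⊗ₜ E ℓ b = K ℓ a 1 ⊗ₜ E ℓ b * cartan ℓ a b := by
  rw [cartan_mul_right hℓ 1 (weight_E b) (fun s => Commute.one_right _), Int.cast_one, one_mul]

theorem cartan_mul_F_tmul (hℓ : ℓ ≠ 0) (a b : G) :
    cartan ℓ a b * F ℓ a ⊗ₜ 1 = F ℓ a ⊗ₜ K ℓ b (-1) * cartan ℓ a b := by
  rw [cartan_mul_left hℓ (-1) (weight_F a) (fun s => Commute.one_right _), Int.cast_neg,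
    Int.cast_one, one_mul]

theorem cartan_mul_tmul_F (hℓ : ℓ ≠ 0) (a b : G) :
    cartan ℓ a b * K ℓ a 1 ⊗ₜ F ℓ b = 1 ⊗ₜ F ℓ b * cartan ℓ a b := by
  rw [cartan_mul_right hℓ (-1) (weight_F b) (fun s => (sat ℓ a).k_comm _ _), Int.cast_neg,
    Int.cast_one, (sat ℓ a).k_neg 1]

theorem rMatrix_mul_comul (hℓ : 3 ≤ ℓ) (a b : G) (x : U ℓ (a + b)) :
    rMatrix ℓ a b * comul ℓ a b x =
      Algebra.TensorProduct.comm ℂ (U ℓ b) (U ℓ a)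
        (comul ℓ b a (gcast ℂ (U ℓ) (add_comm a b) x)) * rMatrix ℓ a b := by
  have hℓ0 : ℓ ≠ 0 := by omega
  induction x using U.induction with
  | algebraMap c =>
    rw [AlgHom.commutes, AlgEquiv.commutes, AlgHom.commutes, AlgEquiv.commutes, Algebra.commutes]
  | E =>
    rw [gcast_E, comul_E, comul_E, rMatrix, mul_assoc, truncatedR_eq_truncated hℓ,
      UK.truncated_mul_e hℓ (sat ℓ a) (sat ℓ b), ← mul_assoc, mul_add, cartan_mul_E_tmul hℓ0,
      cartan_mul_tmul_E hℓ0]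
    simp [add_mul, mul_assoc]
  | F =>
    rw [gcast_F, comul_F, comul_F, rMatrix, mul_assoc, truncatedR_eq_truncated hℓ,
      UK.truncated_mul_f hℓ (sat ℓ a) (sat ℓ b), ← mul_assoc, mul_add, cartan_mul_F_tmul hℓ0,
      cartan_mul_tmul_F hℓ0]
    simp [add_mul, mul_assoc, add_comm]
  | K α =>
    rw [gcast_K, comul_K, comul_K, Algebra.TensorProduct.comm_tmul]
    have h1 : Commute (cartan ℓ a b) (K ℓ a α ⊗ₜ K ℓ b α) := by
      rw [commute_iff_eq, cartan_mul_left hℓ0 0 (fun t => by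
        rw [((sat ℓ a).k_comm t α).eq]; simp [xi_zero]) (fun s => (sat ℓ b).k_comm _ _),
        Int.cast_zero, (sat ℓ b).k_zero, mul_one]
    have h2 : Commute (truncatedR ℓ a b) (K ℓ a α ⊗ₜ K ℓ b α) := by
      rw [truncatedR_eq_qexp hℓ]
      -- E ⊗ F has total weight zero.
      have : Commute (K ℓ a α ⊗ₜ[ℂ] K ℓ b α) (qn ℓ 1 • (E ℓ a ⊗ₜ[ℂ] F ℓ b)) := by
        refine Commute.smul_right ?_ _
        rw [commute_iff_eq, Algebra.TensorProduct.tmul_mul_tmul, Algebra.TensorProduct.tmul_mul_tmul,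
          (sat ℓ a).k_e, (sat ℓ b).k_f, TensorProduct.smul_tmul_smul, neg_mul, xi_mul_neg, one_smul]
      exact (SemiconjBy.qexp this _ _).symm
    exact (h1.mul_left h2).eq
  | add x y hx hy => simp only [map_add, mul_add, add_mul, hx, hy]
  | mul x y hx hy =>
    simp only [map_mul]
    rw [← mul_assoc, hx, mul_assoc, hy, mul_assoc]

open HopfGCoalgebra in
-- Since Δ(K^s) = K^s ⊗ K^s is a product of two toral families, this is multiplicativity of the
-- pairing, with the sum of the lifts of b/2 and c/2 as lift for b + c.
theorem id_comul_cartan (hℓ : ℓ ≠ 0) (a b c : G) :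
    Algebra.TensorProduct.map (AlgHom.id ℂ (U ℓ a)) (comul ℓ b c) (cartan ℓ a (b + c)) =
      leg13 ℂ (U ℓ a) (U ℓ b) (U ℓ c) (cartan ℓ a c) *
        leg12 ℂ (U ℓ a) (U ℓ b) (U ℓ c) (cartan ℓ a b) := by
  have hα := isHalf_out a
  have hβ := isHalf_out b
  have hγ := isHalf_out c
  have hu : IsToral ℓ (fun t => K ℓ a t ⊗ₜ[ℂ] (1 : U ℓ b ⊗[ℂ] U ℓ c)) (Quotient.out a / 2) :=
    (isToral_K hα).map Algebra.TensorProduct.includeLeft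
  have key := pairing_mul hℓ hu
    (fun s => (1 : U ℓ a) ⊗ₜ[ℂ] ((1 : U ℓ b) ⊗ₜ[ℂ] K ℓ c s))
    (fun s => (1 : U ℓ a) ⊗ₜ[ℂ] (K ℓ b s ⊗ₜ[ℂ] (1 : U ℓ c)))
    (fun _ _ => commute_tmul_one_one_tmul _ _) (Quotient.out c / 2) (Quotient.out b / 2)
  rw [cartan_eq_pairing hℓ hα (hβ.add hγ), cartan_eq_pairing hℓ hα hβ, cartan_eq_pairing hℓ hα hγ,
    map_pairing, map_pairing, map_pairing]
  simpa [leg12, leg13, Algebra.TensorProduct.one_def, add_comm] using key.symm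

open HopfGCoalgebra in
-- The same argument after transposing by `pairing_comm`, because `pairing_mul` keeps its first
-- family fixed.
theorem comul_id_cartan (hℓ : ℓ ≠ 0) (a b c : G) :
    Algebra.TensorProduct.assoc ℂ ℂ ℂ (U ℓ a) (U ℓ b) (U ℓ c)
      (Algebra.TensorProduct.map (comul ℓ a b) (AlgHom.id ℂ (U ℓ c)) (cartan ℓ (a + b) c)) =
      leg13 ℂ (U ℓ a) (U ℓ b) (U ℓ c) (cartan ℓ a c) *
        leg23 ℂ (U ℓ a) (U ℓ b) (U ℓ c) (cartan ℓ b c) := by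
  have hα := isHalf_out a
  have hβ := isHalf_out b
  have hγ := isHalf_out c
  have hu : IsToral ℓ (fun t => (1 : U ℓ a) ⊗ₜ[ℂ] ((1 : U ℓ b) ⊗ₜ[ℂ] K ℓ c t))
      (Quotient.out c / 2) :=
    (isToral_right hγ b).map
      (Algebra.TensorProduct.includeRight : _ →ₐ[ℂ] U ℓ a ⊗[ℂ] (U ℓ b ⊗[ℂ] U ℓ c))
  have key := pairing_mul hℓ hu
    (fun s => K ℓ a s ⊗ₜ[ℂ] ((1 : U ℓ b) ⊗ₜ[ℂ] (1 : U ℓ c)))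
    (fun s => (1 : U ℓ a) ⊗ₜ[ℂ] (K ℓ b s ⊗ₜ[ℂ] (1 : U ℓ c)))
    (fun _ _ => (commute_tmul_one_one_tmul _ _).symm) (Quotient.out a / 2) (Quotient.out b / 2)
  have comm : ∀ {b c : G}, ∀ x y, Commute (K ℓ b x ⊗ₜ[ℂ] (1 : U ℓ c)) (1 ⊗ₜ[ℂ] K ℓ c y) :=
    fun _ _ => commute_tmul_one_one_tmul _ _
  rw [cartan_eq_pairing hℓ (hα.add hβ) hγ, cartan_eq_pairing hℓ hβ hγ, cartan_eq_pairing hℓ hα hγ,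
    pairing_comm comm, pairing_comm comm, pairing_comm comm, ← AlgEquiv.coe_toAlgHom,
    map_pairing, map_pairing, map_pairing, map_pairing]
  simpa [leg23, leg13, Algebra.TensorProduct.one_def] using key.symm

theorem commute_leg12 {A B C : Type} [Ring A] [Algebra ℂ A] [Ring B] [Algebra ℂ B] [Ring C]
    [Algebra ℂ C] (x : A ⊗[ℂ] B) (y : C) :
    Commute (HopfGCoalgebra.leg12 ℂ A B C x) (1 ⊗ₜ (1 ⊗ₜ y)) := by
  induction x with
  | zero => simp
  | tmul r s => simp [HopfGCoalgebra.leg12, commute_iff_eq]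
  | add r s hr hs => rw [map_add]; exact hr.add_left hs

open HopfGCoalgebra in
-- Applying Id ⊗ Δ to Ř gives the q-exponential of a sum of two q-commuting terms, hence a product
-- of two q-exponentials. Moving the Cartan part on legs 1 and 2 past the first of them changes E ⊗
-- K^{-1} ⊗ F into E ⊗ 1 ⊗ F, which is the Ř on legs 1 and 3.
theorem rMatrix_id_comul (hℓ : 3 ≤ ℓ) (a b c : G) :
    Algebra.TensorProduct.map (AlgHom.id ℂ (U ℓ a)) (comul ℓ b c) (rMatrix ℓ a (b + c)) =
      leg13 ℂ (U ℓ a) (U ℓ b) (U ℓ c) (rMatrix ℓ a c) *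
        leg12 ℂ (U ℓ a) (U ℓ b) (U ℓ c) (rMatrix ℓ a b) := by
  have hℓ0 : ℓ ≠ 0 := by omega
  have hp := isPrimitiveRoot_xi_neg_two hℓ0
  have hb := (sat ℓ b).k_f (-1)
  have hsemi : SemiconjBy (leg12 ℂ (U ℓ a) (U ℓ b) (U ℓ c) (cartan ℓ a b))
      (qn ℓ 1 • (E ℓ a ⊗ₜ (K ℓ b (-1) ⊗ₜ F ℓ c))) (qn ℓ 1 • (E ℓ a ⊗ₜ ((1 : U ℓ b) ⊗ₜ F ℓ c))) := by
    have e := congrArg (leg12 ℂ (U ℓ a) (U ℓ b) (U ℓ c)) (cartan_mul_E_tmul hℓ0 a b)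
    rw [map_mul, map_mul] at e
    have e1 : ∀ y : U ℓ b, E ℓ a ⊗ₜ[ℂ] (y ⊗ₜ[ℂ] F ℓ c) =
      leg12 ℂ (U ℓ a) (U ℓ b) (U ℓ c) (E ℓ a ⊗ₜ y) * (1 ⊗ₜ (1 ⊗ₜ F ℓ c)) := fun y => by simp [leg12]
    rw [SemiconjBy, mul_smul_comm, smul_mul_assoc, e1, e1, ← mul_assoc, e, mul_assoc, mul_assoc,
      (commute_leg12 _ _).eq]
  have hadd : qn ℓ 1 • (E ℓ a ⊗ₜ[ℂ] (K ℓ b (-1) ⊗ₜ F ℓ c + F ℓ b ⊗ₜ[ℂ] (1 : U ℓ c))) =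
      qn ℓ 1 • (E ℓ a ⊗ₜ[ℂ] (K ℓ b (-1) ⊗ₜ F ℓ c)) +
        qn ℓ 1 • (E ℓ a ⊗ₜ[ℂ] (F ℓ b ⊗ₜ[ℂ] (1 : U ℓ c))) := by
    rw [TensorProduct.tmul_add, smul_add]
  have hexp := qexp_add hp (x := qn ℓ 1 • (E ℓ a ⊗ₜ[ℂ] (K ℓ b (-1) ⊗ₜ F ℓ c)))
    (y := qn ℓ 1 • (E ℓ a ⊗ₜ[ℂ] (F ℓ b ⊗ₜ[ℂ] (1 : U ℓ c))))
    (by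
      have : xi ℓ (-2) * xi ℓ (-2 * -1) = 1 := by simpa using xi_mul_neg ℓ (-2)
      simp only [smul_mul_smul_comm, Algebra.TensorProduct.tmul_mul_tmul, mul_one, one_mul, hb,
        ← TensorProduct.smul_tmul', TensorProduct.tmul_smul, smul_smul]
      congr 1; linear_combination -qn ℓ 1 * qn ℓ 1 * this)
    -- Both terms carry E in the first leg, so x^i y^j contains E^{i+j}, which is 0 once i + j ≥ ℓ'.
    (fun i j hij => by
      rw [smul_pow, smul_pow, smul_mul_smul_comm, Algebra.TensorProduct.tmul_pow,
        Algebra.TensorProduct.tmul_pow (E ℓ a), Algebra.TensorProduct.tmul_mul_tmul,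
        ← pow_add (E ℓ a), pow_eq_zero_of_le hij (sat ℓ a).e_pow, TensorProduct.zero_tmul, smul_zero])
  rw [rMatrix, rMatrix, rMatrix, map_mul, map_mul, map_mul, id_comul_cartan hℓ0,
    truncatedR_eq_qexp hℓ, truncatedR_eq_qexp hℓ, truncatedR_eq_qexp hℓ, map_qexp, map_qexp,
    map_qexp, map_smul, map_smul, map_smul, Algebra.TensorProduct.map_tmul, comul_F, AlgHom.id_apply,
    hadd, hexp, mul_assoc, ← mul_assoc (leg12 _ _ _ _ _), (hsemi.qexp _ _).eq, mul_assoc, mul_assoc]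
  simp [leg12, leg13]

open HopfGCoalgebra in
theorem rMatrix_comul_id (hℓ : 3 ≤ ℓ) (a b c : G) :
    Algebra.TensorProduct.assoc ℂ ℂ ℂ (U ℓ a) (U ℓ b) (U ℓ c)
      (Algebra.TensorProduct.map (comul ℓ a b) (AlgHom.id ℂ (U ℓ c)) (rMatrix ℓ (a + b) c)) =
      leg13 ℂ (U ℓ a) (U ℓ b) (U ℓ c) (rMatrix ℓ a c) *
        leg23 ℂ (U ℓ a) (U ℓ b) (U ℓ c) (rMatrix ℓ b c) := by
  have hℓ0 : ℓ ≠ 0 := by omega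
  have hp := isPrimitiveRoot_xi_neg_two hℓ0
  have hb : K ℓ b 1 * E ℓ b = xi ℓ 2 • (E ℓ b * K ℓ b 1) := by simpa using (sat ℓ b).k_e 1
  have hsemi : SemiconjBy (leg23 ℂ (U ℓ a) (U ℓ b) (U ℓ c) (cartan ℓ b c))
      (qn ℓ 1 • (E ℓ a ⊗ₜ (K ℓ b 1 ⊗ₜ F ℓ c))) (qn ℓ 1 • (E ℓ a ⊗ₜ ((1 : U ℓ b) ⊗ₜ F ℓ c))) := by
    rw [SemiconjBy, mul_smul_comm, smul_mul_assoc]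
    simp [leg23, cartan_mul_tmul_F hℓ0 b c]
  have hadd : qn ℓ 1 • (E ℓ a ⊗ₜ[ℂ] (K ℓ b 1 ⊗ₜ[ℂ] F ℓ c) + 1 ⊗ₜ[ℂ] (E ℓ b ⊗ₜ[ℂ] F ℓ c)) =
      qn ℓ 1 • (E ℓ a ⊗ₜ[ℂ] (K ℓ b 1 ⊗ₜ[ℂ] F ℓ c)) + qn ℓ 1 • (1 ⊗ₜ[ℂ] (E ℓ b ⊗ₜ[ℂ] F ℓ c)) :=
    smul_add _ _ _
  have hexp := qexp_add hp (x := qn ℓ 1 • (E ℓ a ⊗ₜ[ℂ] (K ℓ b 1 ⊗ₜ[ℂ] F ℓ c)))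
    (y := qn ℓ 1 • ((1 : U ℓ a) ⊗ₜ[ℂ] (E ℓ b ⊗ₜ[ℂ] F ℓ c)))
    (by
      have : xi ℓ (-2) * xi ℓ 2 = 1 := by simpa using xi_mul_neg ℓ (-2)
      simp only [smul_mul_smul_comm, Algebra.TensorProduct.tmul_mul_tmul, mul_one, one_mul, hb,
        ← TensorProduct.smul_tmul', TensorProduct.tmul_smul, smul_smul]
      congr 1; linear_combination -qn ℓ 1 * qn ℓ 1 * this)
    (fun i j hij => by
      rw [smul_pow, smul_pow, smul_mul_smul_comm, Algebra.TensorProduct.tmul_pow,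
        Algebra.TensorProduct.tmul_pow, Algebra.TensorProduct.tmul_pow,
        Algebra.TensorProduct.tmul_pow, Algebra.TensorProduct.tmul_mul_tmul,
        Algebra.TensorProduct.tmul_mul_tmul, ← pow_add (F ℓ c),
        pow_eq_zero_of_le hij (sat ℓ c).f_pow,
        TensorProduct.tmul_zero, TensorProduct.tmul_zero, smul_zero])
  have hmap : Algebra.TensorProduct.assoc ℂ ℂ ℂ (U ℓ a) (U ℓ b) (U ℓ c)
      (Algebra.TensorProduct.map (comul ℓ a b) (AlgHom.id ℂ (U ℓ c))
        (truncatedR ℓ (a + b) c)) = qexp (xi ℓ (-2)) (ell' ℓ)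
        (qn ℓ 1 • (E ℓ a ⊗ₜ[ℂ] (K ℓ b 1 ⊗ₜ[ℂ] F ℓ c) + 1 ⊗ₜ[ℂ] (E ℓ b ⊗ₜ[ℂ] F ℓ c))) := by
    rw [truncatedR_eq_qexp hℓ, map_qexp, ← AlgEquiv.coe_toAlgHom, map_qexp]
    simp [TensorProduct.add_tmul, add_comm]
  rw [rMatrix, rMatrix, rMatrix, map_mul, map_mul, map_mul, map_mul, comul_id_cartan hℓ0, hmap,
    hadd, hexp, truncatedR_eq_qexp hℓ, truncatedR_eq_qexp hℓ, map_qexp, map_qexp, map_smul, map_smul,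
    mul_assoc, ← mul_assoc (leg23 _ _ _ _ _), (hsemi.qexp _ _).eq, mul_assoc, mul_assoc]
  simp [leg23, leg13]

/-! ### The pivot and the ribbon axiom. -/

theorem isPivot (hℓ : 3 ≤ ℓ) : (hopf hℓ).IsPivot (pivot ℓ) where
  comul_eq a b := comul_K a b _
  counit_eq := counit_K hℓ _
  antipode_antipode a x := by
    have hs := sat ℓ a
    have h := (isToral_K (ℓ := ℓ) (isHalf_out a)).neg.period
    have e1 : K ℓ a (1 - ell' ℓ) = K ℓ a 1 * K ℓ a (-ell' ℓ) := by rw [hs.k_mul, sub_eq_add_neg]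
    have e2 : K ℓ a (-(1 - ell' ℓ)) = K ℓ a (ell' ℓ) * K ℓ a (-1) := by
      rw [hs.k_mul]; congr 1; ring
    -- K^{-ℓ'} is a scalar in U_a, so K^{1-ℓ'} induces the same conjugation as K.
    have e3 : K ℓ a (-ell' ℓ) * x = x * K ℓ a (-ell' ℓ) := by
      rw [h, smul_mul_assoc, mul_smul_comm, one_mul, mul_one]
    refine (U.antipode_antipode a x).trans ?_
    change _ = K ℓ a (1 - ell' ℓ) * x * K ℓ a (-(1 - ell' ℓ))
    rw [e1, e2, mul_assoc (K ℓ a 1) _ x, e3]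
    simp only [mul_assoc]
    rw [← mul_assoc (K ℓ a (-ell' ℓ)), hs.k_neg', one_mul]

theorem isRMatrix (hℓ : 3 ≤ ℓ) : (hopf hℓ).IsRMatrix (rMatrix ℓ) where
  isUnit := isUnit_rMatrix hℓ
  mul_comul := rMatrix_mul_comul hℓ
  id_comul := rMatrix_id_comul hℓ
  comul_id := rMatrix_comul_id hℓ

theorem cartan_mul (hℓ : ℓ ≠ 0) {a : G} {α : ℂ} (hα : IsHalf α a) (x y : U ℓ a) :
    cartan ℓ a a * x ⊗ₜ y = (1 / (ell' ℓ : ℂ)) • ∑ i ∈ Finset.range (ell' ℓ),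
      ∑ j ∈ Finset.range (ell' ℓ), xi ℓ (-2 * (α + i) * (α + j)) •
        ((K ℓ a (α + i) * x) ⊗ₜ (K ℓ a (α + j) * y)) := by
  rw [cartan_eq_pairing hℓ hα hα, pairing, smul_mul_assoc, Finset.sum_mul]
  simp only [Finset.sum_mul, smul_mul_assoc, Algebra.TensorProduct.tmul_mul_tmul, one_mul, mul_one]

/-- Evaluates the multiplied-out legs of the Cartan part around elements of opposite weights d and
-d. Moving K to the right leaves the character ξ^{2(c+t)d}; its part depending on t is absorbed as
K^d, so the pairing factors out independently of x and y. -/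
theorem sum_weight_mul (hℓ : ℓ ≠ 0) {a : G} {α : ℂ} (hα : IsHalf α a) {x y : U ℓ a} (c : ℂ) (d : ℤ)
    (hx : ∀ t, K ℓ a t * x = xi ℓ (2 * t * d) • (x * K ℓ a t))
    (hy : ∀ t, K ℓ a t * y = xi ℓ (-2 * t * d) • (y * K ℓ a t)) :
    (1 / (ell' ℓ : ℂ)) • ∑ i ∈ Finset.range (ell' ℓ), ∑ j ∈ Finset.range (ell' ℓ),
      xi ℓ (-2 * (α + i) * (α + j)) •
        (K ℓ a (α + j) * y * (K ℓ a c * (K ℓ a (α + i) * x))) =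
      xi ℓ (2 * c * d) • (y * x * K ℓ a d * K ℓ a c) * pairing ℓ (K ℓ a) (K ℓ a) α α := by
  have hs := sat ℓ a
  have hp : Commute (K ℓ a d * K ℓ a c) (pairing ℓ (K ℓ a) (K ℓ a) α α) := by
    refine Commute.smul_right (Commute.sum_right _ _ _ fun i _ => Commute.sum_right _ _ _
      fun j _ => Commute.smul_right (Commute.mul_left ?_ ?_) _) _ <;>
    exact (hs.k_comm _ _).mul_right (hs.k_comm _ _)
  rw [smul_mul_assoc, mul_assoc _ (K ℓ a d), mul_assoc _ (K ℓ a d * _), hp.eq, ← mul_assoc _ (K ℓ a d),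
    ← sum_xi_smul_mul hℓ (isToral_K hα) d]
  simp only [mul_smul_comm, smul_mul_assoc, Finset.mul_sum, Finset.sum_mul]
  rw [smul_comm (xi ℓ (2 * c * d))]
  congr 1
  rw [Finset.smul_sum]
  refine Finset.sum_congr rfl fun i _ => ?_
  rw [Finset.smul_sum]
  refine Finset.sum_congr rfl fun j _ => ?_
  rw [hy, smul_mul_assoc, mul_assoc y, ← mul_assoc (K ℓ a c), ← mul_assoc (K ℓ a (α + j)), hs.k_mul,
    hs.k_mul, hx, hs.k_mul, hs.k_mul, mul_smul_comm, smul_smul, smul_smul, smul_smul, ← xi_add,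
    ← xi_add, ← xi_add, ← mul_assoc y x]
  congr 2
  · ring
  · congr 1; ring

theorem isRibbon (hℓ : 3 ≤ ℓ) : (hopf hℓ).IsRibbon (pivot ℓ) (rMatrix ℓ) where
  pivot := isPivot hℓ
  rMatrix := isRMatrix hℓ
  twist a := by
    have hℓ0 : ℓ ≠ 0 := by omega
    have hs := sat ℓ a
    have hα := isHalf_out a
    set α : ℂ := Quotient.out a / 2
    -- The scalar from moving the pivot past weight n; ξ^{2ℓ'n} = 1 reduces it to q^n for q = ξ².
    have hq : ∀ n : ℕ, xi ℓ (2 * (1 - ell' ℓ) * n) = xi ℓ 2 ^ n := fun n => by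
      have := xi_two_ell'_mul hℓ0 (-n)
      rw [show 2 * (1 - (ell' ℓ : ℂ)) * n = n * 2 + 2 * ell' ℓ * (-n : ℤ) by push_cast; ring, xi_add,
        this, mul_one, xi_natCast_mul]
    change LinearMap.mul' ℂ (U ℓ a) (TensorProduct.comm ℂ (U ℓ a) (U ℓ a)
        (K ℓ a (1 - ell' ℓ) ⊗ₜ[ℂ] 1 * rMatrix ℓ a a)) =
      LinearMap.mul' ℂ (U ℓ a) (1 ⊗ₜ[ℂ] K ℓ a (-(1 - ell' ℓ)) * rMatrix ℓ a a)
    have hwE : ∀ (n : ℕ) t, K ℓ a t * E ℓ a ^ n = xi ℓ (2 * t * n) • (E ℓ a ^ n * K ℓ a t) :=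
      fun n t => hs.k_e_pow t n
    have hwF : ∀ (n : ℕ) t, K ℓ a t * F ℓ a ^ n = xi ℓ (-2 * t * n) • (F ℓ a ^ n * K ℓ a t) :=
      fun n t => hs.k_f_pow t n
    have hleft : ∀ n : ℕ, LinearMap.mul' ℂ (U ℓ a) (TensorProduct.comm ℂ (U ℓ a) (U ℓ a)
        (K ℓ a (1 - ell' ℓ) ⊗ₜ[ℂ] 1 * (cartan ℓ a a * (E ℓ a ^ n) ⊗ₜ (F ℓ a ^ n)))) =
        xi ℓ 2 ^ n • (F ℓ a ^ n * E ℓ a ^ n * K ℓ a n * K ℓ a (1 - ell' ℓ)) *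
          pairing ℓ (K ℓ a) (K ℓ a) α α := fun n => by
      have e := sum_weight_mul hℓ0 hα (x := E ℓ a ^ n) (y := F ℓ a ^ n) (1 - ell' ℓ) n
        (by simpa using hwE n) (by simpa using hwF n)
      rw [Int.cast_natCast, hq] at e
      rw [← e, cartan_mul hℓ0 hα]
      simp only [mul_smul_comm, Finset.mul_sum, map_smul, map_sum,
        Algebra.TensorProduct.tmul_mul_tmul, one_mul, TensorProduct.comm_tmul,
        LinearMap.mul'_apply]
    have hright : ∀ n : ℕ, LinearMap.mul' ℂ (U ℓ a)
        (1 ⊗ₜ[ℂ] K ℓ a (-(1 - ell' ℓ)) * (cartan ℓ a a * (E ℓ a ^ n) ⊗ₜ (F ℓ a ^ n))) =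
        xi ℓ 2 ^ n • (E ℓ a ^ n * F ℓ a ^ n * K ℓ a (-n) * K ℓ a (-(1 - ell' ℓ))) *
          pairing ℓ (K ℓ a) (K ℓ a) α α := fun n => by
      have e := sum_weight_mul hℓ0 hα (x := F ℓ a ^ n) (y := E ℓ a ^ n) (-(1 - ell' ℓ)) (-n)
        (by simpa using hwF n) (by simpa using hwE n)
      rw [Int.cast_neg, Int.cast_natCast,
        show (2 * -(1 - (ell' ℓ : ℂ)) * -n) = 2 * (1 - ell' ℓ) * n by ring, hq] at e
      -- Here the E leg stands first in the product, so the two summation indices exchange roles;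
      -- the kernel is symmetric.
      rw [← e, cartan_mul hℓ0 hα, Finset.sum_comm]
      simp only [mul_smul_comm, Finset.mul_sum, map_smul, map_sum,
        Algebra.TensorProduct.tmul_mul_tmul, one_mul, LinearMap.mul'_apply]
      congr 1
      refine Finset.sum_congr rfl fun i _ => Finset.sum_congr rfl fun j _ => ?_
      congr 2; ring
    have key := congrArg (· * pairing ℓ (K ℓ a) (K ℓ a) α α) (hs.twist_sum hℓ)
    simp only [rMatrix, truncatedR_eq_truncated hℓ, UK.truncated, Finset.mul_sum, mul_smul_comm,
      map_sum, map_smul, hleft, hright]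
    simpa only [Finset.sum_mul, smul_mul_assoc, mul_smul, smul_mul_assoc] using key

end U

end QuantumSl2

theorem mainTheorem4 (ℓ : ℕ) (hℓ : 3 ≤ ℓ) :
    (∀ (a b : QuantumSl2.G) (α β : ℂ), QuantumSl2.U.IsHalf α a → QuantumSl2.U.IsHalf β b →
      QuantumSl2.U.cartanSum ℓ a b α β = QuantumSl2.U.cartan ℓ a b) ∧
    (QuantumSl2.U.hopf hℓ).IsRibbon (QuantumSl2.U.pivot ℓ) (QuantumSl2.U.rMatrix ℓ) :=
  ⟨fun _ _ _ _ hα hβ => QuantumSl2.U.cartanSum_eq_cartan (by omega) hα hβ,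
    QuantumSl2.U.isRibbon hℓ⟩
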